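/- **Setting.** Let $\mathcal H$ be a separable complex Hilbert space, $A^\circ_1,\dots,A^\circ_k$ bounded operators on $\mathcal H$, and $A(z)=I-\sum_{h=1}^kA^\circ_hz^h=\sum_{n\ge0}A_n(1-z)^n$. Assume that $A(z)$ has a unit root of finite type: $A(1)\ne0$; $A(1)=A_0$ is Fredholm (finite-dimensional kernel, closed range of finite codimension) with $\operatorname{Ker}A_0\ne\{0\}$; and, for some $\rho>1$, $A(z)$ is invertible for all $|z|<\rho$, $z\neq1$. Let $(\varepsilon_t)_{t\in\mathbb Z}$ be an $\mathcal H$-valued white noise: $0<E\|\varepsilon_t\|^2<\infty$, $E\varepsilon_t=0$, $E\langle h,\varepsilon_t\rangle\overline{\langle v,\varepsilon_t\rangle}$ does not depend on $t$, and $E\langle h,\varepsilon_t\rangle\overline{\langle v,\varepsilon_s\rangle}=0$ for $s\ne t$ and all $h,v\in\mathcal H$. Call it nondegenerate if its covariance operator is injective. Let $(x_t)_{t\in\mathbb Z}$ be a square integrable solution of $x_t=A^\circ_1x_{t-1}+\dots+A^\circ_kx_{t-k}+\varepsilon_t$, $t\in\mathbb Z$, with $E\|x_t\|^2$ bounded by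 a polynomial in $|t|$. **Order of integration.** Let $\Delta u_t=u_t-u_{t-1}$ and let $d\ge0$ be an integer. An $\mathcal H$-valued (resp. scalar) process $z_t$ is $I(d)$ if $u_t=\Delta^dz_t$ has an expectation and $u_t-E u_t=\sum_{n\ge0}B_n\varepsilon_{t-n}$ almost surely for every $t$, where the $B_n$ are bounded operators on $\mathcal H$ with $B_0=I$ (resp. bounded linear functionals on $\mathcal H$), $\sum_n\|B_n\||z|^n<\infty$ for $|z|<\rho'$, for some $\rho'>1$, and $\sum_nB_n\ne0$. The cointegrating space of an $I(d)$ process $x_t$ is $\{v:\langle v,x_t\rangle\text{ is }I(b)\text{ for some }b<d\}\cup\{0\}$, and its attractor space is the orthogonal complement of that set. **Subspaces.** Write $P_\eta$ for the orthogonal projection onto $\eta$ and $A_0^+$ for the generalized (Moore–Penrose) inverse of $A_0$. Put $\zeta_0=\operatorname{Im}A_0$, $\tau_0=(\operatorname{Ker}A_0)^\bot$; $S_1=P_{\zeta_0^\bot}A_1P_{\tau_0^\bot}$, $\zeta_1=\operatorname{Im}S_1$, $\tau_1=(\operatorname{Ker}S_1)^\bot$; $A_{2,1}=A_2-A_1A_0^+A_1$,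 $S_2=P_{(\zeta_0\oplus\zeta_1)^\bot}A_{2,1}P_{(\tau_0\oplus\tau_1)^\bot}$, $\tau_2=(\operatorname{Ker}S_2)^\bot$. The POLE(2) condition is the orthogonal direct sum decomposition $\mathcal H=\tau_0\oplus\tau_1\oplus\tau_2$ with $\tau_2\ne\{0\}$. **Theorem (Characterization of $I(2)$ ARs).** If $\varepsilon_t$ is nondegenerate, then $x_t$ is $I(2)$ if and only if the POLE(2) condition holds. If the POLE(2) condition holds (whether or not $\varepsilon_t$ is nondegenerate), then $x_t$ is $I(2)$ and: 1. Near $z=1$, $z\neq 1$, one has $A(z)^{-1}=\sum_{n\ge0}C_n(1-z)^{n-2}$ with $C_0,C_1$ of finite rank and $\operatorname{Im}C_0=\tau_2$. Moreover $x_t$ has the common trends representation $$x_t=C_0s_{2,t}+C_1s_{1,t}+y_t+\mu_t\quad\text{a.s.},\qquad \mu_t=v_0+v_1t,\qquad t\in\mathbb Z.$$ Here $s_{h,t}=\mathcal S^h\varepsilon_t$, where $\mathcal Sw_t=\sum_{i=1}^tw_i$ for $t\ge1$, $\mathcal Sw_0=0$, and $\mathcal Sw_t=-\sum_{i=t+1}^0w_i$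 for $t\le-1$; $y_t=\sum_{n\ge0}C^\star_n\varepsilon_{t-n}$ a.s., where $C^\star(z)=\sum_nC^\star_nz^n$ is absolutely convergent on a disc of radius larger than $1$ centred at $0$, and $C^\star(z)=A(z)^{-1}-C_0(1-z)^{-2}-C_1(1-z)^{-1}$ there for $z\neq 1$; and $v_0=x_0-y_0$, $v_1=\Delta x_0-\Delta y_0-C_1\varepsilon_0$ a.s. are determined by initial values. Finally $E y_t=0$ and $E x_t=E v_0+t\,E v_1$ for all $t$. 2. $\tau_2$ is finite dimensional, $\tau_1\subsetneq\tau_0^\bot$ and $\tau_2=(\tau_0\oplus\tau_1)^\bot\ne\{0\}$. If $\mathcal H$ is infinite dimensional, so is $\tau_0\oplus\tau_1$. If $\varepsilon_t$ is nondegenerate, then $\operatorname{Im}C_0=\tau_2$ is the attractor space and $\tau_0\oplus\tau_1$ is the cointegrating space of $x_t$. 3. For every nonzero $v\in\mathcal H$: if $v\in\tau_0$, then $\langle v,x_t\rangle+\langle v,A_0^+A_1\Delta x_t\rangle$ is $I(0)$; if $v\in\tau_1$, then $\langle v,x_t\rangle$ is $I(1)$; if $v\in\tau_2$, then $\langle v,x_t\rangle$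 is $I(2)$. -/

import Mathlib

open MeasureTheory

noncomputable section

/-! ## Autoregressive operator functions -/

section Operators

variable {H : Type*} [NormedAddCommGroup H] [InnerProductSpace ℂ H] [CompleteSpace H]

/-- The operator function `A(z) = I - ∑_{h=1}^k z^h a_h`. -/
def arPoly (k : ℕ) (a : ℕ → H →L[ℂ] H) (z : ℂ) : H →L[ℂ] H :=
  1 - ∑ h ∈ Finset.Icc 1 k, z ^ h • a h

/-- The coefficients `A_n` of the expansion `A(z) = ∑ₙ (1 - z)^n A_n` around `z = 1`. -/
def arCoeff (k : ℕ) (a : ℕ → H →L[ℂ] H) (n : ℕ) : H →L[ℂ] H :=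
  if n = 0 then 1 - ∑ h ∈ Finset.Icc 1 k, a h
  else (-1 : ℂ) ^ (n + 1) • ∑ j ∈ Finset.Icc n k, (j.choose n : ℂ) • a j

/-- `A(z) = I - ∑_{h=1}^k z^h a_h` has a unit root of finite type at `z = 1`: it is nonzero at `1`,
`1` is an eigenvalue of finite type (`A(1)` is Fredholm with nontrivial kernel), and `A(z)` is
invertible in the disc `|z| < ρ` with the point `1` removed, for some `ρ > 1`. -/
structure HasUnitRootOfFiniteType (k : ℕ) (a : ℕ → H →L[ℂ] H) : Prop where
  ne_zero : arPoly k a 1 ≠ 0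
  fredholm : (arPoly k a 1).IsFredholm
  exists_ker : ∃ v : H, v ≠ 0 ∧ arPoly k a 1 v = 0
  invertible : ∃ ρ : ℝ, 1 < ρ ∧ ∀ z : ℂ, ‖z‖ < ρ → z ≠ 1 → IsUnit (arPoly k a z)

/-- The four Penrose equations: `G` is the generalized inverse of `A`. -/
structure IsGeneralizedInverse (A G : H →L[ℂ] H) : Prop where
  mul_mul : A * G * A = A
  mul_mul_inv : G * A * G = G
  left_selfAdjoint : IsSelfAdjoint (A * G)
  right_selfAdjoint : IsSelfAdjoint (G * A)

theorem IsGeneralizedInverse.unique {A G G' : H →L[ℂ] H} (h : IsGeneralizedInverse A G)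
    (h' : IsGeneralizedInverse A G') : G = G' := by
  have e1 : A * G = A * G' := by
    have h1 : star (A * G) = A * G := h.left_selfAdjoint
    have h2 : star (A * G') = A * G' := h'.left_selfAdjoint
    calc A * G = (A * G') * (A * G) := by rw [← mul_assoc, h'.mul_mul]
      _ = star (A * G') * star (A * G) := by rw [h1, h2]
      _ = star ((A * G) * (A * G')) := (star_mul _ _).symm
      _ = star (A * G') := by rw [← mul_assoc, h.mul_mul]
      _ = A * G' := h2
  have e2 : G * A = G' * A := by
    have h1 : star (G * A) = G * A := h.right_selfAdjoint
    have h2 : star (G' * A) = G' * A := h'.right_selfAdjoint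
    calc G * A = (G * A) * (G' * A) := by rw [mul_assoc, ← mul_assoc A, h'.mul_mul]
      _ = star (G * A) * star (G' * A) := by rw [h1, h2]
      _ = star ((G' * A) * (G * A)) := (star_mul _ _).symm
      _ = star (G' * A) := by rw [mul_assoc, ← mul_assoc A, h.mul_mul]
      _ = G' * A := h2
  calc G = G * (A * G) := by rw [← mul_assoc, h.mul_mul_inv]
    _ = G' * A * G' := by rw [e1, ← mul_assoc, e2]
    _ = G' := h'.mul_mul_inv

theorem exists_isGeneralizedInverse {A : H →L[ℂ] H} (hA : IsClosed (A.range : Set H)) :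
    ∃ G : H →L[ℂ] H, IsGeneralizedInverse A G := by
  have : CompleteSpace A.range := hA.completeSpace_coe
  have : CompleteSpace A.ker := A.isClosed_ker.completeSpace_coe
  have hA1 : ∀ x : H, A (A.kerᗮ.starProjection x) = A x := by
    intro x
    have h1 : A (A.ker.starProjection x) = 0 := A.ker.starProjection_apply_mem x
    have h2 : A.ker.starProjection x + A.kerᗮ.starProjection x = x := by
      rw [Submodule.starProjection_orthogonal_val, add_sub_cancel]
    conv_rhs => rw [← h2, map_add, h1, zero_add]
  let f : A.kerᗮ →L[ℂ] A.range :=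
    (A.comp A.kerᗮ.subtypeL).codRestrict A.range (fun x => ⟨x, rfl⟩)
  have hf : ∀ x : A.kerᗮ, (f x : H) = A x := fun x => rfl
  have hinj : f.ker = ⊥ := by
    rw [LinearMap.ker_eq_bot']
    intro x hx
    have h0 : A (x : H) = 0 := by
      rw [← hf]
      exact congrArg Subtype.val hx
    have h1 : (x : H) ∈ A.ker ⊓ A.kerᗮ := ⟨h0, x.2⟩
    rw [Submodule.inf_orthogonal_eq_bot] at h1
    exact Subtype.ext h1
  have hsurj : f.range = ⊤ := by
    rw [LinearMap.range_eq_top]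
    rintro ⟨y, x, rfl⟩
    exact ⟨⟨A.kerᗮ.starProjection x, A.kerᗮ.starProjection_apply_mem x⟩, Subtype.ext (hA1 x)⟩
  let e := ContinuousLinearEquiv.ofBijective f hinj hsurj
  let G : H →L[ℂ] H :=
    A.kerᗮ.subtypeL.comp ((e.symm : A.range →L[ℂ] A.kerᗮ).comp A.range.orthogonalProjectionOnto)
  have hAG : A * G = A.range.starProjection := by
    ext y
    have h1 : f (e.symm (A.range.orthogonalProjectionOnto y)) = A.range.orthogonalProjectionOnto y :=
      e.apply_symm_apply _
    have h2 := congrArg Subtype.val h1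
    rw [hf] at h2
    exact h2
  have hGA : G * A = A.kerᗮ.starProjection := by
    ext y
    have h1 : A.range.orthogonalProjectionOnto (A y) = f (A.kerᗮ.orthogonalProjectionOnto y) := by
      apply Subtype.ext
      rw [hf, ← Submodule.starProjection_apply, ← Submodule.starProjection_apply, hA1]
      exact Submodule.starProjection_eq_self_iff.2 ⟨y, rfl⟩
    have h2 : e.symm (f (A.kerᗮ.orthogonalProjectionOnto y)) = A.kerᗮ.orthogonalProjectionOnto y :=
      e.symm_apply_apply _
    change ((e.symm (A.range.orthogonalProjectionOnto (A y)) : A.kerᗮ) : H) = _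
    rw [h1, h2, Submodule.starProjection_apply]
  refine ⟨G, ?_, ?_, ?_, ?_⟩
  · rw [hAG]
    ext y
    exact Submodule.starProjection_eq_self_iff.2 ⟨y, rfl⟩
  · rw [hGA]
    ext y
    exact Submodule.starProjection_eq_self_iff.2 (Subtype.mem _)
  · rw [hAG]
    exact isSelfAdjoint_starProjection _
  · rw [hGA]
    exact isSelfAdjoint_starProjection _

open Classical in
/-- The generalized inverse `A⁺` of a bounded operator with closed range (and `0` by convention if
no bounded generalized inverse exists). -/
def generalizedInverse (A : H →L[ℂ] H) : H →L[ℂ] H :=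
  if h : ∃ G : H →L[ℂ] H, IsGeneralizedInverse A G then h.choose else 0

theorem generalizedInverse_spec {A : H →L[ℂ] H} (hA : IsClosed (A.range : Set H)) :
    IsGeneralizedInverse A (generalizedInverse A) := by
  have h := exists_isGeneralizedInverse hA
  rw [generalizedInverse, dif_pos h]
  exact h.choose_spec

/-- `ζ₀ = Im A₀`. -/
def zeta0 (k : ℕ) (a : ℕ → H →L[ℂ] H) : Submodule ℂ H := (arCoeff k a 0).range

/-- `τ₀ = (Ker A₀)^⊥`. -/
def tau0 (k : ℕ) (a : ℕ → H →L[ℂ] H) : Submodule ℂ H := (arCoeff k a 0).kerᗮ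

/-- `S₁ = P_{ζ₀^⊥} A₁ P_{τ₀^⊥}`. -/
def S1 (k : ℕ) (a : ℕ → H →L[ℂ] H) : H →L[ℂ] H :=
  (zeta0 k a)ᗮ.starProjection * arCoeff k a 1 * (tau0 k a)ᗮ.starProjection

/-- `ζ₁ = Im S₁`. -/
def zeta1 (k : ℕ) (a : ℕ → H →L[ℂ] H) : Submodule ℂ H := (S1 k a).range

/-- `τ₁ = (Ker S₁)^⊥`. -/
def tau1 (k : ℕ) (a : ℕ → H →L[ℂ] H) : Submodule ℂ H := (S1 k a).kerᗮ

/-- `A_{2,1} = A₂ - A₁ A₀⁺ A₁`. -/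
def arCoeff21 (k : ℕ) (a : ℕ → H →L[ℂ] H) : H →L[ℂ] H :=
  arCoeff k a 2 - arCoeff k a 1 * generalizedInverse (arCoeff k a 0) * arCoeff k a 1

/-- `S₂ = P_{(ζ₀ ⊕ ζ₁)^⊥} A_{2,1} P_{(τ₀ ⊕ τ₁)^⊥}`. -/
def S2 (k : ℕ) (a : ℕ → H →L[ℂ] H) : H →L[ℂ] H :=
  (zeta0 k a ⊔ zeta1 k a)ᗮ.starProjection * arCoeff21 k a *
    (tau0 k a ⊔ tau1 k a)ᗮ.starProjection

/-- `τ₂ = (Ker S₂)^⊥`. -/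
def tau2 (k : ℕ) (a : ℕ → H →L[ℂ] H) : Submodule ℂ H := (S2 k a).kerᗮ

/-- The orthogonal direct sum condition `H = τ₀ ⊕ τ₁ ⊕ τ₂` with `τ₂ ≠ 0`. -/
structure PoleTwoCondition (k : ℕ) (a : ℕ → H →L[ℂ] H) : Prop where
  ortho01 : tau0 k a ⟂ tau1 k a
  ortho02 : tau0 k a ⟂ tau2 k a
  ortho12 : tau1 k a ⟂ tau2 k a
  sup_eq_top : tau0 k a ⊔ tau1 k a ⊔ tau2 k a = ⊤
  ne_bot : tau2 k a ≠ ⊥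

/-- `A(z)⁻¹ = ∑ₙ (1 - z)^(n - d) C_n` in a punctured neighbourhood of `z = 1`. -/
def IsLaurentExpansionOfInverse (k : ℕ) (a : ℕ → H →L[ℂ] H) (d : ℕ) (C : ℕ → H →L[ℂ] H) : Prop :=
  ∃ δ : ℝ, 0 < δ ∧ ∀ z : ℂ, ‖z - 1‖ < δ → z ≠ 1 →
    HasSum (fun n : ℕ => (1 - z) ^ ((n : ℤ) - (d : ℤ)) • C n) (Ring.inverse (arPoly k a z))

end Operators

/-! ## Processes indexed by the integers -/

section Processes

/-- The difference operator `Δ = 1 - L`. -/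
def diffOp {M : Type*} [AddCommGroup M] (u : ℤ → M) : ℤ → M := fun t => u t - u (t - 1)

/-- The cumulation operator: `∑_{i=1}^t w_i` for `t ≥ 1`, `0` for `t = 0`, and
`-∑_{i=t+1}^0 w_i` for `t ≤ -1`. -/
def cumul {M : Type*} [AddCommGroup M] (w : ℤ → M) : ℤ → M := fun t =>
  ∑ i ∈ Finset.Icc 1 t, w i - ∑ i ∈ Finset.Icc (t + 1) 0, w i

variable {H : Type*} [NormedAddCommGroup H] [InnerProductSpace ℂ H] [CompleteSpace H]
variable {Ω : Type*} [MeasurableSpace Ω]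

/-- The process `⟨v, x_t⟩`. -/
def characteristic (v : H) (x : ℤ → Ω → H) : ℤ → Ω → ℂ := fun t ω => inner ℂ v (x t ω)

/-- The cross-covariance function `(h, v) ↦ E(⟨h, Z - E Z⟩ conj ⟨v, U - E U⟩)`. -/
def crossCov (P : Measure Ω) (Z U : Ω → H) (h v : H) : ℂ :=
  ∫ ω, inner ℂ h (Z ω - ∫ ω', Z ω' ∂P) * starRingEnd ℂ (inner ℂ v (U ω - ∫ ω', U ω' ∂P)) ∂P

structure IsWeaklyStationary (P : Measure Ω) (ε : ℤ → Ω → H) : Prop where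
  memLp : ∀ t, MemLp (ε t) 2 P
  pos : ∀ t, 0 < ∫ ω, ‖ε t ω‖ ^ 2 ∂P
  mean_eq : ∀ s t, ∫ ω, ε s ω ∂P = ∫ ω, ε t ω ∂P
  cov_eq : ∀ s t h v, crossCov P (ε s) (ε s) h v = crossCov P (ε t) (ε t) h v
  crossCov_shift : ∀ s t r h v,
    crossCov P (ε t) (ε s) h v = crossCov P (ε (t + r)) (ε (s + r)) h v

structure IsWhiteNoise (P : Measure Ω) (ε : ℤ → Ω → H) : Prop
    extends IsWeaklyStationary P ε where
  mean_zero : ∀ t, ∫ ω, ε t ω ∂P = 0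
  uncorrelated : ∀ s t, s ≠ t → ∀ h v, crossCov P (ε t) (ε s) h v = 0

/-- The covariance operator of each `ε_t` is injective: no nonzero `⟨v, ε_t⟩` has variance `0`. -/
def IsNondegenerate (P : Measure Ω) (ε : ℤ → Ω → H) : Prop :=
  ∀ t v, v ≠ 0 → crossCov P (ε t) (ε t) v v ≠ 0

/-- `x` is a solution of the autoregressive equations
`x_t = a_1 x_{t-1} + ⋯ + a_k x_{t-k} + ε_t`, `t ∈ ℤ`, whose second moments are finite and
grow at most polynomially in `|t|`. -/
structure IsARSolution (P : Measure Ω) (k : ℕ) (a : ℕ → H →L[ℂ] H) (ε x : ℤ → Ω → H) :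
    Prop where
  memLp : ∀ t, MemLp (x t) 2 P
  equation : ∀ t : ℤ, ∀ᵐ ω ∂P,
    x t ω = ∑ h ∈ Finset.Icc 1 k, a h (x (t - (h : ℤ)) ω) + ε t ω
  growth : ∃ (c : ℝ) (m : ℕ), ∀ t : ℤ, ∫ ω, ‖x t ω‖ ^ 2 ∂P ≤ c * (1 + |(t : ℝ)|) ^ m

section Linear

variable {K : Type*} [NormedAddCommGroup K] [NormedSpace ℂ K]

/-- `∑ₙ ‖B_n‖ |z|^n` is finite on a disc `|z| < ρ` with `ρ > 1`. -/
def IsAbsolutelyConvergent (B : ℕ → H →L[ℂ] K) : Prop :=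
  ∃ ρ : ℝ, 1 < ρ ∧ ∀ z : ℂ, ‖z‖ < ρ → Summable (fun n : ℕ => ‖B n‖ * ‖z‖ ^ n)

/-- `u_t - E(u_t) = ∑ₙ B_n ε_{t-n}` for every `t`, where `B(z) = ∑ₙ B_n z^n` is absolutely
convergent on a disc of radius larger than `1`. -/
structure IsLinearFilterOf (P : Measure Ω) (ε : ℤ → Ω → H) (B : ℕ → H →L[ℂ] K)
    (u : ℤ → Ω → K) : Prop where
  absConv : IsAbsolutelyConvergent B
  integrable : ∀ t, Integrable (u t) P
  hasSum : ∀ t : ℤ, ∀ᵐ ω ∂P,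
    HasSum (fun n : ℕ => B n (ε (t - (n : ℤ)) ω)) (u t ω - ∫ ω', u t ω' ∂P)

end Linear

/-- `z_t ∼ I(d)` for an `H`-valued process driven by the white noise `ε`: `Δ^d z_t` is a linear
process `B(L) ε_t` around its mean, with `B_0 = I` and `B(1) ≠ 0`. -/
def IsIntegratedOfOrder (P : Measure Ω) (ε : ℤ → Ω → H) (d : ℕ) (z : ℤ → Ω → H) : Prop :=
  ∃ B : ℕ → H →L[ℂ] H, B 0 = 1 ∧ IsLinearFilterOf P ε B (diffOp^[d] z) ∧ ∑' n, B n ≠ 0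

/-- `w_t ∼ I(d)` for a scalar process driven by the `H`-valued white noise `ε`: `Δ^d w_t` is
`b(L) ε_t` around its mean, where the `b_n` are bounded linear functionals and `b(1) ≠ 0`. -/
def IsScalarIntegratedOfOrder (P : Measure Ω) (ε : ℤ → Ω → H) (d : ℕ) (w : ℤ → Ω → ℂ) : Prop :=
  ∃ b : ℕ → H →L[ℂ] ℂ, IsLinearFilterOf P ε b (diffOp^[d] w) ∧ ∑' n, b n ≠ 0

/-- The cointegrating space of an `I(d)` process:
all `v` with `⟨v, x_t⟩ ∼ I(b)` for some `b < d`, together with `0`. -/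
def cointegratingSpace (P : Measure Ω) (ε : ℤ → Ω → H) (d : ℕ) (x : ℤ → Ω → H) : Set H :=
  {v | ∃ b < d, IsScalarIntegratedOfOrder P ε b (characteristic v x)} ∪ {0}

/-- The attractor space: the orthogonal complement of the cointegrating space. -/
def attractorSpace (P : Measure Ω) (ε : ℤ → Ω → H) (d : ℕ) (x : ℤ → Ω → H) : Submodule ℂ H :=
  (Submodule.span ℂ (cointegratingSpace P ε d x))ᗮ

/-- The common trends representation for `d = 2`,
`x_t = C_0 s_{2,t} + C_1 s_{1,t} + y_t + v_0 + t v_1`, where `s_h` is the `h`-fold cumulation of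
`ε`, `y_t = C⋆(L) ε_t` with `C⋆(z) = A(z)⁻¹ - (1 - z)^(-2) C_0 - (1 - z)^(-1) C_1`, and `v_0`, `v_1`
are determined by initial values. -/
structure IsCommonTrendsRepresentationTwo (P : Measure Ω) (k : ℕ) (a : ℕ → H →L[ℂ] H)
    (ε x : ℤ → Ω → H) (C Cstar : ℕ → H →L[ℂ] H) (y : ℤ → Ω → H) (v₀ v₁ : Ω → H) : Prop where
  finite_rank : ∀ n < 2, FiniteDimensional ℂ (C n).range
  cstar_eq : ∃ ρ : ℝ, 1 < ρ ∧ ∀ z : ℂ, ‖z‖ < ρ → z ≠ 1 →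
    HasSum (fun n : ℕ => z ^ n • Cstar n)
      (Ring.inverse (arPoly k a z) - ((1 - z) ^ 2)⁻¹ • C 0 - (1 - z)⁻¹ • C 1)
  linear : IsLinearFilterOf P ε Cstar y
  mean_zero : ∀ t, ∫ ω, y t ω ∂P = 0
  v₀_eq : ∀ᵐ ω ∂P, v₀ ω = x 0 ω - y 0 ω
  v₁_eq : ∀ᵐ ω ∂P, v₁ ω = diffOp x 0 ω - diffOp y 0 ω - C 1 (ε 0 ω)
  representation : ∀ t : ℤ, ∀ᵐ ω ∂P,
    x t ω = C 0 (cumul (cumul ε) t ω) + C 1 (cumul ε t ω) + y t ω + (v₀ ω + (t : ℂ) • v₁ ω)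
  expectation : ∀ t : ℤ, ∫ ω, x t ω ∂P = ∫ ω, v₀ ω ∂P + (t : ℂ) • ∫ ω, v₁ ω ∂P

end Processes

end

/-! The proof translates statements about processes into statements about holomorphic operator
functions. A power series in the lag operator that converges on a disc of radius larger than 1 can
be applied almost surely to any process whose second moments grow polynomially, and lags,
differences and bounded operators act on such symbols by multiplication. The bridge is
`IsARSolution.isFilterOf_noise`: if φ(z)A(z) = ψ(z), then ψ(L)x = φ(L)ε. Hence Δ²x is a filter of ε
as soon as F(z) = (1-z)²A(z)⁻¹ extends holomorphically over z = 1, and ⟨v, x_t⟩ is I(b) as soon as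
(1-z)^b⟨v,·⟩ = φ(z)A(z) with φ holomorphic and φ(1) ≠ 0.

POLE(2) gives a double pole. The operator `pivot` M = A₀ + A₁P_{τ₁} + A_{2,1}P_{(τ₀⊕τ₁)^⊥} is
injective by a triangular argument, and it is a finite-rank perturbation of an invertible operator
up to an invertible factor, hence invertible. An explicit polynomial right factor turns A(z) into
(1-z)²(M + O(1-z)) (`HasUnitRootOfFiniteType.arPoly_mul_rightFactor`), so F is holomorphic at 1 and
F(1)M is the orthogonal projection onto (τ₀⊕τ₁)^⊥. This identity yields Im C₀ and the nonvanishing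
of the leading functionals.

Conversely, in a nondegenerate white noise a filter that is almost surely constant has zero symbol
(`IsNondegenerate.symbol_eq_zero`). An I(2) solution therefore provides F with A(z)F(z) = (1-z)² and
F(1) ≠ 0. Comparing coefficients at z = 1 gives v = C₀A_{2,1}v on (τ₀⊕τ₁)^⊥, while C₀ vanishes on
the closure of ζ₀⊕ζ₁; so S₂ is injective there (`IsCoeffInverse.poleTwoCondition`).

For cointegration, suitable functionals are divided by A(z) explicitly (`IsTransfer`), and
uniqueness of symbols forces every cointegrating vector to be orthogonal to Im F(1). The common
trends formula holds because the remainder has zero second difference, hence is affine in t. -/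

/-! ## Power series on discs of radius larger than one -/

section DiscSeries

variable {E : Type*} [NormedAddCommGroup E] [NormedSpace ℂ E]
variable {E' : Type*} [NormedAddCommGroup E'] [NormedSpace ℂ E']

/-- The power series `∑ₙ z^n B_n` converges absolutely to `F z` on a disc of radius larger
than `1`. -/
def IsDiscSeries (B : ℕ → E) (F : ℂ → E) : Prop :=
  ∃ ρ : ℝ, 1 < ρ ∧ ∀ z : ℂ, ‖z‖ < ρ →
    Summable (fun n : ℕ => ‖B n‖ * ‖z‖ ^ n) ∧ HasSum (fun n : ℕ => z ^ n • B n) (F z)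

theorem IsDiscSeries.congr {B : ℕ → E} {F F' : ℂ → E} (h : IsDiscSeries B F) {r : ℝ} (hr : 1 < r)
    (hF : ∀ z : ℂ, ‖z‖ < r → F z = F' z) : IsDiscSeries B F' := by
  obtain ⟨ρ, hρ, H⟩ := h
  refine ⟨min ρ r, lt_min hρ hr, fun z hz => ?_⟩
  rw [← hF z (hz.trans_le (min_le_right _ _))]
  exact H z (hz.trans_le (min_le_left _ _))

theorem IsDiscSeries.add {B B' : ℕ → E} {F F' : ℂ → E} (h : IsDiscSeries B F)
    (h' : IsDiscSeries B' F') : IsDiscSeries (fun n => B n + B' n) (fun z => F z + F' z) := by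
  obtain ⟨ρ, hρ, H⟩ := h
  obtain ⟨ρ', hρ', H'⟩ := h'
  refine ⟨min ρ ρ', lt_min hρ hρ', fun z hz => ?_⟩
  obtain ⟨h1, h2⟩ := H z (hz.trans_le (min_le_left _ _))
  obtain ⟨h1', h2'⟩ := H' z (hz.trans_le (min_le_right _ _))
  constructor
  · refine Summable.of_nonneg_of_le (fun n => by positivity) (fun n => ?_) (h1.add h1')
    rw [← add_mul]
    exact mul_le_mul_of_nonneg_right (norm_add_le _ _) (by positivity)
  · simpa only [smul_add] using h2.add h2'

theorem IsDiscSeries.map {B : ℕ → E} {F : ℂ → E} (T : E →L[ℂ] E') (h : IsDiscSeries B F) :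
    IsDiscSeries (fun n => T (B n)) (fun z => T (F z)) := by
  obtain ⟨ρ, hρ, H⟩ := h
  refine ⟨ρ, hρ, fun z hz => ?_⟩
  obtain ⟨h1, h2⟩ := H z hz
  constructor
  · refine Summable.of_nonneg_of_le (fun n => by positivity) (fun n => ?_) (h1.mul_left ‖T‖)
    rw [← mul_assoc]
    exact mul_le_mul_of_nonneg_right (T.le_opNorm _) (by positivity)
  · simpa only [map_smul] using h2.mapL T

/-- The sequence `0, B_0, B_1, …`. -/
def delay (B : ℕ → E) : ℕ → E
  | 0 => 0
  | n + 1 => B n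

theorem IsDiscSeries.delay {B : ℕ → E} {F : ℂ → E} (h : IsDiscSeries B F) :
    IsDiscSeries (delay B) (fun z => z • F z) := by
  obtain ⟨ρ, hρ, H⟩ := h
  refine ⟨ρ, hρ, fun z hz => ?_⟩
  obtain ⟨h1, h2⟩ := H z hz
  constructor
  · rw [← summable_nat_add_iff 1]
    refine (h1.mul_right ‖z‖).congr fun n => ?_
    simp only [_root_.delay, pow_succ, mul_assoc]
  · rw [← hasSum_nat_add_iff' 1]
    simpa [_root_.delay, pow_succ', mul_smul] using h2.const_smul z

theorem isDiscSeries_const (c : E) : IsDiscSeries (Pi.single 0 c) (fun _ => c) := by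
  refine ⟨2, by norm_num, fun z _ => ⟨?_, ?_⟩⟩
  · refine summable_of_ne_finset_zero (s := {0}) fun n hn => ?_
    rw [Finset.mem_singleton] at hn
    simp [hn]
  · have h := hasSum_single (f := fun n : ℕ => z ^ n • (Pi.single 0 c : ℕ → E) n) 0
      (fun n hn => by simp [hn])
    simpa using h

theorem IsDiscSeries.one {B : ℕ → E} {F : ℂ → E} (h : IsDiscSeries B F) :
    HasSum B (F 1) ∧ Summable (fun n => ‖B n‖) := by
  obtain ⟨ρ, hρ, H⟩ := h
  have h1 := H 1 (by simpa using hρ)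
  exact ⟨by simpa using h1.2, by simpa using h1.1⟩

/-- The formal power series with coefficients `B`. -/
noncomputable def formalSeries (B : ℕ → E) : FormalMultilinearSeries ℂ ℂ E :=
  fun n => ContinuousMultilinearMap.mkPiRing ℂ (Fin n) (B n)

@[simp]
theorem formalSeries_coeff (B : ℕ → E) (n : ℕ) : (formalSeries B).coeff n = B n := by
  simp [formalSeries, FormalMultilinearSeries.coeff]

@[simp]
theorem norm_formalSeries (B : ℕ → E) (n : ℕ) : ‖formalSeries B n‖ = ‖B n‖ := by
  simp [formalSeries]

theorem IsDiscSeries.hasFPowerSeriesAt {B : ℕ → E} {F : ℂ → E} (h : IsDiscSeries B F) :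
    HasFPowerSeriesAt F (formalSeries B) 0 := by
  obtain ⟨ρ, hρ, H⟩ := h
  rw [hasFPowerSeriesAt_iff]
  filter_upwards [Metric.ball_mem_nhds (0 : ℂ) (zero_lt_one.trans hρ)] with z hz
  have := (H z (by simpa using hz)).2
  simpa using this

/-- Agreement near 0 suffices, so symbols can be compared away from the unit root. -/
theorem IsDiscSeries.coeff_eq {B B' : ℕ → E} {F F' : ℂ → E} (h : IsDiscSeries B F)
    (h' : IsDiscSeries B' F') (hF : ∀ᶠ z in nhds (0 : ℂ), F z = F' z) : B = B' := by
  have h1 := h.hasFPowerSeriesAt.congr hF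
  have h2 := h1.eq_formalMultilinearSeries h'.hasFPowerSeriesAt
  funext n
  have h3 := congrArg (fun p => FormalMultilinearSeries.coeff p n) h2
  simpa using h3

theorem IsDiscSeries.differentiableOn [CompleteSpace E] {B : ℕ → E} {F : ℂ → E}
    (h : IsDiscSeries B F) :
    ∃ ρ : ℝ, 1 < ρ ∧ DifferentiableOn ℂ F (Metric.ball 0 ρ) := by
  obtain ⟨ρ, hρ, H⟩ := h
  refine ⟨ρ, hρ, ?_⟩
  -- Absolute summability at every r < ρ bounds the radius of convergence from below.
  have hrad : ENNReal.ofReal ρ ≤ (formalSeries B).radius := by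
    refine ENNReal.le_of_forall_nnreal_lt fun r hr => ?_
    refine (formalSeries B).le_radius_of_summable_norm ?_
    have hr' : (r : ℝ) < ρ := by
      rw [← ENNReal.ofReal_coe_nnreal] at hr
      exact (ENNReal.ofReal_lt_ofReal_iff (zero_lt_one.trans hρ)).1 hr
    have := (H (r : ℂ) (by simpa using hr')).1
    simpa using this
  have hb : HasFPowerSeriesOnBall F (formalSeries B) 0 (ENNReal.ofReal ρ) := by
    refine ⟨hrad, by simpa using zero_lt_one.trans hρ, fun {y} hy => ?_⟩
    have hy' : ‖y‖ < ρ := by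
      have := hy
      rw [Metric.eball_ofReal] at this
      simpa using this
    simpa using (H y hy').2
  have := hb.differentiableOn
  rwa [Metric.eball_ofReal] at this

theorem exists_isDiscSeries [CompleteSpace E] {F : ℂ → E} {ρ : ℝ} (hρ : 1 < ρ)
    (h : DifferentiableOn ℂ F (Metric.ball 0 ρ)) : ∃ B : ℕ → E, IsDiscSeries B F := by
  -- Cauchy's formula needs a closed disc inside the domain; an intermediate radius keeps the series
  -- convergent beyond 1.
  obtain ⟨r, hr1, hr2⟩ := exists_between hρ
  lift r to NNReal using (zero_lt_one.trans hr1).le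
  have hp := (h.mono (Metric.closedBall_subset_ball hr2)).hasFPowerSeriesOnBall
    (by exact_mod_cast zero_lt_one.trans hr1)
  set p := cauchyPowerSeries F 0 r
  refine ⟨p.coeff, r, hr1, fun z hz => ⟨?_, ?_⟩⟩
  · have h1 : (↑(‖z‖₊) : ENNReal) < p.radius := by
      refine lt_of_lt_of_le ?_ hp.r_le
      exact_mod_cast hz
    simpa [FormalMultilinearSeries.norm_apply_eq_norm_coef] using p.summable_norm_mul_pow h1
  · have := hp.hasSum (y := z) (by
      rw [Metric.mem_eball, edist_zero_right]
      simpa [enorm] using (by exact_mod_cast hz : ‖z‖₊ < r))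
    simpa using this

end DiscSeries

/-! ## Symbols of linear processes -/

section Symbols

variable {H : Type*} [NormedAddCommGroup H] [NormedSpace ℂ H]
variable {K : Type*} [NormedAddCommGroup K] [NormedSpace ℂ K]
variable {K' : Type*} [NormedAddCommGroup K'] [NormedSpace ℂ K']
variable {Ω : Type*} [MeasurableSpace Ω] {P : Measure Ω}

/-- `u_t = ∑ₙ B_n e_{t-n}` almost surely, for every `t`. -/
def IsFilterOf (P : Measure Ω) (e : ℤ → Ω → H) (B : ℕ → H →L[ℂ] K) (u : ℤ → Ω → K) : Prop :=
  ∀ t : ℤ, ∀ᵐ ω ∂P, HasSum (fun n : ℕ => B n (e (t - (n : ℤ)) ω)) (u t ω)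

/-- The process `u` is the linear filter `F(L) e` of the process `e`, where `F` is a power series
on a disc of radius larger than `1`. -/
def HasSymbol (P : Measure Ω) (e : ℤ → Ω → H) (F : ℂ → H →L[ℂ] K) (u : ℤ → Ω → K) : Prop :=
  ∃ B : ℕ → H →L[ℂ] K, IsDiscSeries B F ∧ IsFilterOf P e B u

variable {e : ℤ → Ω → H} {F F' : ℂ → H →L[ℂ] K} {u u' : ℤ → Ω → K}

/-- Equal symbols have equal coefficients, and a sum of a series is unique. -/
theorem HasSymbol.ae_eq (h : HasSymbol P e F u) (h' : HasSymbol P e F' u')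
    (hF : ∀ᶠ z in nhds (0 : ℂ), F z = F' z) (t : ℤ) : u t =ᵐ[P] u' t := by
  obtain ⟨B, hB, hu⟩ := h
  obtain ⟨B', hB', hu'⟩ := h'
  obtain rfl := hB.coeff_eq hB' hF
  filter_upwards [hu t, hu' t] with ω h1 h2
  exact h1.unique h2

theorem HasSymbol.congr (h : HasSymbol P e F u) {r : ℝ} (hr : 1 < r)
    (hF : ∀ z : ℂ, ‖z‖ < r → F z = F' z) : HasSymbol P e F' u := by
  obtain ⟨B, hB, hu⟩ := h
  exact ⟨B, hB.congr hr hF, hu⟩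

theorem HasSymbol.congr_ae (h : HasSymbol P e F u) (hu : ∀ t, u t =ᵐ[P] u' t) :
    HasSymbol P e F u' := by
  obtain ⟨B, hB, hB'⟩ := h
  refine ⟨B, hB, fun t => ?_⟩
  filter_upwards [hB' t, hu t] with ω h1 h2
  rwa [← h2]

theorem HasSymbol.add (h : HasSymbol P e F u) (h' : HasSymbol P e F' u') :
    HasSymbol P e (fun z => F z + F' z) (fun t ω => u t ω + u' t ω) := by
  obtain ⟨B, hB, hu⟩ := h
  obtain ⟨B', hB', hu'⟩ := h'
  refine ⟨_, hB.add hB', fun t => ?_⟩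
  filter_upwards [hu t, hu' t] with ω h1 h2
  simpa using h1.add h2

theorem HasSymbol.clm_comp (h : HasSymbol P e F u) (T : K →L[ℂ] K') :
    HasSymbol P e (fun z => T.comp (F z)) (fun t ω => T (u t ω)) := by
  obtain ⟨B, hB, hu⟩ := h
  refine ⟨_, hB.map (ContinuousLinearMap.compL ℂ H K K' T), fun t => ?_⟩
  filter_upwards [hu t] with ω h1
  simpa using h1.mapL T

theorem HasSymbol.neg (h : HasSymbol P e F u) :
    HasSymbol P e (fun z => -F z) (fun t ω => -u t ω) := by
  have := h.clm_comp (-ContinuousLinearMap.id ℂ K)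
  simpa using this

theorem HasSymbol.sub (h : HasSymbol P e F u) (h' : HasSymbol P e F' u') :
    HasSymbol P e (fun z => F z - F' z) (fun t ω => u t ω - u' t ω) := by
  simpa only [sub_eq_add_neg] using h.add h'.neg

theorem HasSymbol.lag (h : HasSymbol P e F u) :
    HasSymbol P e (fun z => z • F z) (fun t => u (t - 1)) := by
  obtain ⟨B, hB, hu⟩ := h
  refine ⟨_, hB.delay, fun t => ?_⟩
  filter_upwards [hu (t - 1)] with ω h1
  rw [← hasSum_nat_add_iff' 1]
  simpa [delay, sub_sub, add_comm (1 : ℤ)] using h1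

theorem HasSymbol.lag_pow (h : HasSymbol P e F u) (m : ℕ) :
    HasSymbol P e (fun z => z ^ m • F z) (fun t => u (t - (m : ℤ))) := by
  induction m with
  | zero => simpa using h
  | succ m ih =>
    have := ih.lag
    simpa [smul_smul, pow_succ', sub_sub, add_comm (1 : ℤ)] using this

theorem HasSymbol.diff (h : HasSymbol P e F u) :
    HasSymbol P e (fun z => (1 - z) • F z) (diffOp u) := by
  simpa only [sub_smul, one_smul] using! h.sub h.lag

theorem HasSymbol.diff_iterate (h : HasSymbol P e F u) (m : ℕ) :
    HasSymbol P e (fun z => (1 - z) ^ m • F z) (diffOp^[m] u) := by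
  induction m with
  | zero => simpa using h
  | succ m ih =>
    rw [Function.iterate_succ_apply']
    simpa only [smul_smul, ← pow_succ'] using ih.diff

theorem hasSymbol_zero : HasSymbol P e (fun _ => (0 : H →L[ℂ] K)) (fun _ _ => 0) :=
  ⟨_, isDiscSeries_const 0, fun t => Filter.Eventually.of_forall fun ω => by simp⟩

theorem hasSymbol_self : HasSymbol P e (fun _ => (1 : H →L[ℂ] H)) e := by
  refine ⟨_, isDiscSeries_const 1, fun t => Filter.Eventually.of_forall fun ω => ?_⟩
  have h := hasSum_single
    (f := fun n : ℕ => (Pi.single 0 1 : ℕ → H →L[ℂ] H) n (e (t - (n : ℤ)) ω)) 0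
    (fun n hn => by simp [hn])
  simpa using h

theorem HasSymbol.sum {ι : Type*} (s : Finset ι) {F : ι → ℂ → H →L[ℂ] K} {u : ι → ℤ → Ω → K}
    (h : ∀ i ∈ s, HasSymbol P e (F i) (u i)) :
    HasSymbol P e (fun z => ∑ i ∈ s, F i z) (fun t ω => ∑ i ∈ s, u i t ω) := by
  classical
  induction s using Finset.induction_on with
  | empty => simpa using hasSymbol_zero
  | insert i s hi ih =>
    simp only [Finset.sum_insert hi]
    exact (h i (Finset.mem_insert_self i s)).add
      (ih fun j hj => h j (Finset.mem_insert_of_mem hj))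

end Symbols

/-! ## Linear filters of processes with polynomial growth -/

section Growth

/-- The coefficients decay geometrically because the radius exceeds 1, and this absorbs polynomial
growth of moments. It is the reason a polynomial growth bound suffices for all filters to converge.
-/
theorem summable_mul_polynomial_of_isDiscSeries {E : Type*} [NormedAddCommGroup E]
    [NormedSpace ℂ E] {B : ℕ → E} {F : ℂ → E} (hB : IsDiscSeries B F) {g : ℤ → ℝ}
    (hg0 : ∀ t, 0 ≤ g t) {c : ℝ} {m : ℕ} (hg : ∀ t : ℤ, g t ≤ c * (1 + |(t : ℝ)|) ^ m) (t : ℤ) :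
    Summable (fun n : ℕ => ‖B n‖ * g (t - (n : ℤ))) := by
  obtain ⟨ρ, hρ, H⟩ := hB
  obtain ⟨r, hr1, hr2⟩ := exists_between hρ
  have hr0 : 0 < r := zero_lt_one.trans hr1
  have hr := (H (r : ℂ) (by simpa [abs_of_pos hr0] using hr2)).1
  simp only [Complex.norm_real, Real.norm_eq_abs, abs_of_pos hr0] at hr
  have hlim := tendsto_pow_const_mul_const_pow_of_lt_one m (inv_nonneg.2 hr0.le)
    (inv_lt_one_of_one_lt₀ hr1)
  obtain ⟨D, hD⟩ := hlim.bddAbove_range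
  have hD' : ∀ n : ℕ, ((n : ℝ) + 1) ^ m ≤ D * r ^ (n + 1) := by
    intro n
    have h1 := hD ⟨n + 1, rfl⟩
    simp only [inv_pow] at h1
    rw [← div_eq_mul_inv, div_le_iff₀ (by positivity)] at h1
    exact_mod_cast h1
  have hc : 0 ≤ c := by
    have := (hg0 0).trans (hg 0)
    simpa using this
  refine Summable.of_nonneg_of_le (fun n => mul_nonneg (norm_nonneg _) (hg0 _)) (fun n => ?_)
    (hr.mul_left (c * (1 + |(t : ℝ)|) ^ m * D * r))
  -- Separating t from n lets the dependence on t be pulled out of the series.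
  have h1 : 1 + |((t - (n : ℤ) : ℤ) : ℝ)| ≤ (1 + |(t : ℝ)|) * (n + 1) := by
    push_cast
    have h2 : |(t : ℝ) - n| ≤ |(t : ℝ)| + n := (abs_sub _ _).trans (by simp)
    nlinarith [abs_nonneg (t : ℝ), mul_nonneg (abs_nonneg (t : ℝ)) (Nat.cast_nonneg (α := ℝ) n)]
  have h3 : g (t - (n : ℤ)) ≤ c * (1 + |(t : ℝ)|) ^ m * (D * r ^ (n + 1)) := by
    refine (hg _).trans ?_
    rw [mul_assoc]
    refine mul_le_mul_of_nonneg_left ?_ hc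
    refine (pow_le_pow_left₀ (by positivity) h1 m).trans ?_
    rw [mul_pow]
    exact mul_le_mul_of_nonneg_left (hD' n) (by positivity)
  calc ‖B n‖ * g (t - (n : ℤ)) ≤ ‖B n‖ * (c * (1 + |(t : ℝ)|) ^ m * (D * r ^ (n + 1))) :=
        mul_le_mul_of_nonneg_left h3 (norm_nonneg _)
    _ = c * (1 + |(t : ℝ)|) ^ m * D * r * (‖B n‖ * r ^ n) := by ring

variable {Ω : Type*} [MeasurableSpace Ω] {P : Measure Ω}

/-- By Tonelli the sum of the norms has finite integral, so it is finite almost surely. -/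
theorem ae_summable_norm_of_summable_integral_norm {E : Type*} [NormedAddCommGroup E]
    {f : ℕ → Ω → E} (hf : ∀ n, Integrable (f n) P) (hs : Summable fun n => ∫ ω, ‖f n ω‖ ∂P) :
    (∀ᵐ ω ∂P, Summable fun n => ‖f n ω‖) ∧ Integrable (fun ω => ∑' n, ‖f n ω‖) P := by
  have h1 : ∑' n, ∫⁻ ω, ‖f n ω‖ₑ ∂P ≠ ⊤ := by
    have h2 : ∀ n, ∫⁻ ω, ‖f n ω‖ₑ ∂P = ENNReal.ofReal (∫ ω, ‖f n ω‖ ∂P) := fun n =>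
      (ofReal_integral_norm_eq_lintegral_enorm (hf n)).symm
    simp only [h2]
    exact hs.tsum_ofReal_ne_top
  have h3 : ∀ᵐ ω ∂P, Summable fun n => ‖f n ω‖ :=
    summable_norm_of_tsum_eLpNorm_ne_top le_rfl (fun n => (hf n).1)
      (by simpa only [eLpNorm_one_eq_lintegral_enorm] using h1)
  refine ⟨h3, ?_, ?_⟩
  · refine aestronglyMeasurable_of_tendsto_ae Filter.atTop
      (f := fun N ω => ∑ n ∈ Finset.range N, ‖f n ω‖)
      (fun N => Finset.aestronglyMeasurable_fun_sum _ fun n _ => (hf n).1.norm) ?_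
    filter_upwards [h3] with ω hω using hω.hasSum.tendsto_sum_nat
  · rw [hasFiniteIntegral_iff_enorm]
    refine lt_of_le_of_lt ?_ h1.lt_top
    rw [← lintegral_tsum fun n => (hf n).1.enorm]
    refine lintegral_mono_ae ?_
    filter_upwards [h3] with ω hω
    exact enorm_tsum_le_tsum_enorm.trans (by simp)

variable {H : Type*} [NormedAddCommGroup H]

/-- The second moments of the process `e` grow at most polynomially. -/
structure HasPolynomialGrowth (P : Measure Ω) (e : ℤ → Ω → H) : Prop where
  memLp : ∀ t, MemLp (e t) 2 P
  growth : ∃ (c : ℝ) (m : ℕ), ∀ t : ℤ, ∫ ω, ‖e t ω‖ ^ 2 ∂P ≤ c * (1 + |(t : ℝ)|) ^ m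

namespace HasPolynomialGrowth

variable {e e' : ℤ → Ω → H}

theorem integrable_norm_sq (h : HasPolynomialGrowth P e) (t : ℤ) :
    Integrable (fun ω => ‖e t ω‖ ^ 2) P := by
  simpa using (h.memLp t).integrable_norm_pow two_ne_zero

theorem integrable [IsProbabilityMeasure P] (h : HasPolynomialGrowth P e) (t : ℤ) :
    Integrable (e t) P :=
  (h.memLp t).integrable (by norm_num)

theorem integral_norm_le [IsProbabilityMeasure P] (h : HasPolynomialGrowth P e) (t : ℤ) :
    ∫ ω, ‖e t ω‖ ∂P ≤ 1 + ∫ ω, ‖e t ω‖ ^ 2 ∂P := by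
  have h1 : ∫ ω, ‖e t ω‖ ∂P ≤ ∫ ω, (1 + ‖e t ω‖ ^ 2) ∂P := by
    refine integral_mono (h.integrable t).norm
      ((integrable_const _).add (h.integrable_norm_sq t)) fun ω => ?_
    change ‖e t ω‖ ≤ 1 + ‖e t ω‖ ^ 2
    nlinarith [sq_nonneg (‖e t ω‖ - 1), norm_nonneg (e t ω)]
  rw [integral_add (integrable_const _) (h.integrable_norm_sq t)] at h1
  simpa using h1

variable [NormedSpace ℂ H] {K : Type*} [NormedAddCommGroup K] [NormedSpace ℂ K]

theorem summable_norm_sq {B : ℕ → H →L[ℂ] K} {F : ℂ → H →L[ℂ] K} (h : HasPolynomialGrowth P e)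
    (hB : IsDiscSeries B F) (t : ℤ) :
    Summable (fun n : ℕ => ‖B n‖ * ∫ ω, ‖e (t - (n : ℤ)) ω‖ ^ 2 ∂P) := by
  obtain ⟨c, m, hc⟩ := h.growth
  exact summable_mul_polynomial_of_isDiscSeries hB
    (fun t => integral_nonneg fun ω => by positivity) hc t

variable [IsProbabilityMeasure P]

theorem summable_integral_norm {B : ℕ → H →L[ℂ] K} {F : ℂ → H →L[ℂ] K}
    (h : HasPolynomialGrowth P e) (hB : IsDiscSeries B F) (t : ℤ) :
    Summable (fun n : ℕ => ∫ ω, ‖B n (e (t - (n : ℤ)) ω)‖ ∂P) := by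
  refine Summable.of_nonneg_of_le (fun n => integral_nonneg fun ω => norm_nonneg _) (fun n => ?_)
    (hB.one.2.add (h.summable_norm_sq hB t))
  rw [← mul_one_add]
  refine le_trans ?_ (mul_le_mul_of_nonneg_left (h.integral_norm_le _) (norm_nonneg _))
  rw [← integral_const_mul]
  exact integral_mono ((B n).integrable_comp (h.integrable _)).norm
    ((h.integrable _).norm.const_mul _) fun ω => (B n).le_opNorm _

theorem isFilterOf_tsum [CompleteSpace K] {B : ℕ → H →L[ℂ] K} {F : ℂ → H →L[ℂ] K}
    (h : HasPolynomialGrowth P e) (hB : IsDiscSeries B F) :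
    IsFilterOf P e B (fun t ω => ∑' n : ℕ, B n (e (t - (n : ℤ)) ω)) := by
  intro t
  filter_upwards [(ae_summable_norm_of_summable_integral_norm
    (fun n => (B n).integrable_comp (h.integrable (t - (n : ℤ))))
    (h.summable_integral_norm hB t)).1] with ω hω
  exact hω.of_norm.hasSum

theorem integrable_of_hasSymbol {F : ℂ → H →L[ℂ] K} {u : ℤ → Ω → K}
    (h : HasPolynomialGrowth P e) (hu : HasSymbol P e F u) (t : ℤ) : Integrable (u t) P := by
  obtain ⟨B, hB, hBu⟩ := hu
  have hi : ∀ n : ℕ, Integrable (fun ω => B n (e (t - (n : ℤ)) ω)) P :=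
    fun n => (B n).integrable_comp (h.integrable (t - (n : ℤ)))
  obtain ⟨h1, h2⟩ := ae_summable_norm_of_summable_integral_norm hi (h.summable_integral_norm hB t)
  refine h2.mono' ?_ ?_
  · refine aestronglyMeasurable_of_tendsto_ae Filter.atTop
      (f := fun N ω => ∑ n ∈ Finset.range N, B n (e (t - (n : ℤ)) ω))
      (fun N => Finset.aestronglyMeasurable_fun_sum _ fun n _ => (hi n).1) ?_
    filter_upwards [hBu t] with ω hω using hω.tendsto_sum_nat
  · filter_upwards [hBu t, h1] with ω hω hω'
    rw [← hω.tsum_eq]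
    exact norm_tsum_le_tsum_norm hω'

theorem integral_eq_zero_of_hasSymbol [CompleteSpace H] [CompleteSpace K]
    {F : ℂ → H →L[ℂ] K} {u : ℤ → Ω → K} (h : HasPolynomialGrowth P e) (hu : HasSymbol P e F u)
    (h0 : ∀ t, ∫ ω, e t ω ∂P = 0) (t : ℤ) :
    ∫ ω, u t ω ∂P = 0 := by
  obtain ⟨B, hB, hBu⟩ := hu
  have hi : ∀ n : ℕ, Integrable (fun ω => B n (e (t - (n : ℤ)) ω)) P :=
    fun n => (B n).integrable_comp (h.integrable (t - (n : ℤ)))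
  have h1 := hasSum_integral_of_summable_integral_norm hi (h.summable_integral_norm hB t)
  have h2 : ∀ n : ℕ, ∫ ω, B n (e (t - (n : ℤ)) ω) ∂P = 0 := fun n => by
    rw [(B n).integral_comp_comm (h.integrable _), h0, map_zero]
  simp only [h2] at h1
  have h3 : ∫ ω, u t ω ∂P = ∫ ω, ∑' n : ℕ, B n (e (t - (n : ℤ)) ω) ∂P := by
    refine integral_congr_ae ?_
    filter_upwards [hBu t] with ω hω using hω.tsum_eq.symm
  rw [h3]
  exact h1.unique hasSum_zero

omit [IsProbabilityMeasure P] [NormedSpace ℂ H] in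
theorem add {e e' : ℤ → Ω → H} (h : HasPolynomialGrowth P e) (h' : HasPolynomialGrowth P e') :
    HasPolynomialGrowth P (fun t ω => e t ω + e' t ω) := by
  refine ⟨fun t => (h.memLp t).add (h'.memLp t), ?_⟩
  obtain ⟨c, m, hc⟩ := h.growth
  obtain ⟨c', m', hc'⟩ := h'.growth
  have key : ∀ (c : ℝ) (m n : ℕ) (t : ℤ), c * (1 + |(t : ℝ)|) ^ m ≤
      |c| * (1 + |(t : ℝ)|) ^ (m + n) := fun c m n t => by
    have h1 : (1 : ℝ) ≤ 1 + |(t : ℝ)| := by simp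
    exact mul_le_mul (le_abs_self c) (pow_le_pow_right₀ h1 (Nat.le_add_right m n))
      (by positivity) (abs_nonneg c)
  refine ⟨2 * (|c| + |c'|), m + m', fun t => ?_⟩
  have h1 : ∫ ω, ‖e t ω + e' t ω‖ ^ 2 ∂P ≤
      ∫ ω, (2 * ‖e t ω‖ ^ 2 + 2 * ‖e' t ω‖ ^ 2) ∂P := by
    refine integral_mono_of_nonneg (Filter.Eventually.of_forall fun ω => by positivity)
      (((h.integrable_norm_sq t).const_mul 2).add ((h'.integrable_norm_sq t).const_mul 2))
      (Filter.Eventually.of_forall fun ω => ?_)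
    change ‖e t ω + e' t ω‖ ^ 2 ≤ 2 * ‖e t ω‖ ^ 2 + 2 * ‖e' t ω‖ ^ 2
    nlinarith [norm_add_le (e t ω) (e' t ω), norm_nonneg (e t ω + e' t ω),
      sq_nonneg (‖e t ω‖ - ‖e' t ω‖)]
  rw [integral_add ((h.integrable_norm_sq t).const_mul 2) ((h'.integrable_norm_sq t).const_mul 2),
    integral_const_mul, integral_const_mul] at h1
  have h2 := (hc t).trans (key c m m' t)
  have h3 := (hc' t).trans (key c' m' m t)
  rw [add_comm m' m] at h3
  linarith

omit [IsProbabilityMeasure P] in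
theorem clm_comp {e : ℤ → Ω → H} (h : HasPolynomialGrowth P e) (T : H →L[ℂ] K) :
    HasPolynomialGrowth P (fun t ω => T (e t ω)) := by
  refine ⟨fun t => T.comp_memLp' (h.memLp t), ?_⟩
  obtain ⟨c, m, hc⟩ := h.growth
  refine ⟨‖T‖ ^ 2 * c, m, fun t => ?_⟩
  have h1 : ∫ ω, ‖T (e t ω)‖ ^ 2 ∂P ≤ ∫ ω, ‖T‖ ^ 2 * ‖e t ω‖ ^ 2 ∂P := by
    refine integral_mono_of_nonneg (Filter.Eventually.of_forall fun ω => by positivity)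
      ((h.integrable_norm_sq t).const_mul _) (Filter.Eventually.of_forall fun ω => ?_)
    change ‖T (e t ω)‖ ^ 2 ≤ ‖T‖ ^ 2 * ‖e t ω‖ ^ 2
    rw [← mul_pow]
    exact pow_le_pow_left₀ (norm_nonneg _) (T.le_opNorm _) 2
  rw [integral_const_mul] at h1
  rw [mul_assoc]
  exact h1.trans (mul_le_mul_of_nonneg_left (hc t) (by positivity))

omit [IsProbabilityMeasure P] [NormedSpace ℂ H] in
theorem shift {e : ℤ → Ω → H} (h : HasPolynomialGrowth P e) (s : ℤ) :
    HasPolynomialGrowth P (fun t => e (t - s)) := by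
  refine ⟨fun t => h.memLp _, ?_⟩
  obtain ⟨c, m, hc⟩ := h.growth
  have hc0 : 0 ≤ c := by
    have := (integral_nonneg fun ω => by positivity).trans (hc 0)
    simpa using this
  refine ⟨c * (1 + |(s : ℝ)|) ^ m, m, fun t => (hc _).trans ?_⟩
  rw [mul_assoc, ← mul_pow]
  refine mul_le_mul_of_nonneg_left (pow_le_pow_left₀ (by positivity) ?_ m) hc0
  push_cast
  nlinarith [abs_sub (t : ℝ) s, mul_nonneg (abs_nonneg (t : ℝ)) (abs_nonneg (s : ℝ))]

omit [IsProbabilityMeasure P] [NormedSpace ℂ H] in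
theorem zero : HasPolynomialGrowth P (fun _ _ => (0 : H)) :=
  ⟨fun _ => MemLp.zero', 0, 0, fun t => by simp⟩

omit [IsProbabilityMeasure P] [NormedSpace ℂ H] in
theorem sum {ι : Type*} (s : Finset ι) {e : ι → ℤ → Ω → H}
    (h : ∀ i ∈ s, HasPolynomialGrowth P (e i)) :
    HasPolynomialGrowth P (fun t ω => ∑ i ∈ s, e i t ω) := by
  classical
  induction s using Finset.induction_on with
  | empty => simpa using zero
  | insert i s hi ih =>
    simp only [Finset.sum_insert hi]
    exact (h i (Finset.mem_insert_self i s)).add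
      (ih fun j hj => h j (Finset.mem_insert_of_mem hj))

omit [IsProbabilityMeasure P] [NormedSpace ℂ H] in
theorem congr_ae {e e' : ℤ → Ω → H} (h : HasPolynomialGrowth P e) (he : ∀ t, e t =ᵐ[P] e' t) :
    HasPolynomialGrowth P e' := by
  refine ⟨fun t => (memLp_congr_ae (he t)).1 (h.memLp t), ?_⟩
  obtain ⟨c, m, hc⟩ := h.growth
  refine ⟨c, m, fun t => ?_⟩
  refine (integral_congr_ae ?_).trans_le (hc t)
  filter_upwards [he t] with ω hω
  rw [hω]

end HasPolynomialGrowth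

end Growth

/-! ## Autoregressive equations -/

section Autoregressive

variable {H : Type*} [NormedAddCommGroup H] [InnerProductSpace ℂ H]
variable {K : Type*} [NormedAddCommGroup K] [NormedSpace ℂ K]
variable {Ω : Type*} [MeasurableSpace Ω] {P : Measure Ω} {k : ℕ} {a : ℕ → H →L[ℂ] H}
variable {ε x : ℤ → Ω → H}

theorem HasSymbol.arPoly_comp {e : ℤ → Ω → K} {F : ℂ → K →L[ℂ] H} {u : ℤ → Ω → H}
    (h : HasSymbol P e F u) (k : ℕ) (a : ℕ → H →L[ℂ] H) :
    HasSymbol P e (fun z => (arPoly k a z).comp (F z))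
      (fun t ω => u t ω - ∑ h ∈ Finset.Icc 1 k, a h (u (t - (h : ℤ)) ω)) := by
  have h1 := h.sub (HasSymbol.sum (Finset.Icc 1 k)
    (fun i _ => (h.lag_pow i).clm_comp (a i)))
  refine h1.congr (r := 2) (by norm_num) fun z _ => ?_
  ext v
  simp [arPoly]

theorem IsARSolution.hasPolynomialGrowth (hx : IsARSolution P k a ε x) :
    HasPolynomialGrowth P x := ⟨hx.memLp, hx.growth⟩

theorem IsARSolution.noise_ae_eq (hx : IsARSolution P k a ε x) (t : ℤ) :
    (fun ω => x t ω - ∑ h ∈ Finset.Icc 1 k, a h (x (t - (h : ℤ)) ω)) =ᵐ[P] ε t := by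
  filter_upwards [hx.equation t] with ω hω
  rw [sub_eq_iff_eq_add, hω, add_comm]

theorem IsARSolution.hasSymbol_noise (hx : IsARSolution P k a ε x) :
    HasSymbol P x (arPoly k a) ε :=
  (hasSymbol_self.arPoly_comp k a).congr_ae hx.noise_ae_eq

theorem IsARSolution.hasPolynomialGrowth_noise (hx : IsARSolution P k a ε x) :
    HasPolynomialGrowth P ε := by
  have h1 : HasPolynomialGrowth P
      (fun t ω => x t ω + ∑ h ∈ Finset.Icc 1 k, (-a h) (x (t - (h : ℤ)) ω)) :=
    hx.hasPolynomialGrowth.add (HasPolynomialGrowth.sum _ fun i _ =>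
      (hx.hasPolynomialGrowth.shift (i : ℤ)).clm_comp (-a i))
  refine h1.congr_ae fun t => ?_
  filter_upwards [hx.noise_ae_eq t] with ω hω
  rw [← hω]
  simp [sub_eq_add_neg]

/-- If `u = G(L) x` and `F(z) A(z) = G(z)`, then `u = F(L) ε`. -/
theorem IsARSolution.isFilterOf_noise [CompleteSpace K] [IsProbabilityMeasure P]
    (hx : IsARSolution P k a ε x)
    {B : ℕ → H →L[ℂ] K} {F G : ℂ → H →L[ℂ] K} {u : ℤ → Ω → K} (hB : IsDiscSeries B F)
    (hu : HasSymbol P x G u) (hG : ∀ᶠ z in nhds (0 : ℂ), (F z).comp (arPoly k a z) = G z) :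
    IsFilterOf P ε B u := by
  have hgr := hx.hasPolynomialGrowth
  have hBa : ∀ i, IsDiscSeries (fun n => (B n).comp (a i)) (fun z => (F z).comp (a i)) := fun i =>
    hB.map ((ContinuousLinearMap.compL ℂ H H K).flip (a i))
  have h0 := hgr.isFilterOf_tsum hB
  have h1 := fun i => hgr.isFilterOf_tsum (hBa i)
  -- The filter is first applied to x and to each a_i x, whose series converge by the growth bound;
  -- the resulting combination has symbol F(z)A(z).
  have h2 := HasSymbol.sub ⟨B, hB, h0⟩ (HasSymbol.sum (Finset.Icc 1 k) fun i _ =>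
    HasSymbol.lag_pow ⟨_, hBa i, h1 i⟩ i)
  have h3 : ∀ᶠ z in nhds (0 : ℂ), (F z - ∑ i ∈ Finset.Icc 1 k, z ^ i • (F z).comp (a i)) = G z := by
    filter_upwards [hG] with z hz
    rw [← hz]
    ext v
    simp [arPoly]
  intro t
  filter_upwards [h2.ae_eq hu h3 t, h0 t,
    (Finset.eventually_all (Finset.Icc 1 k)).2 fun i _ => h1 i (t - (i : ℤ)),
    ae_all_iff.2 fun n : ℕ => hx.noise_ae_eq (t - (n : ℤ))] with ω e1 e2 e3 e4
  rw [← e1]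
  -- A finite combination of convergent series may be regrouped termwise, and the n-th term is B_n
  -- applied to the AR equation at time t - n.
  have e5 := e2.sub (hasSum_sum e3)
  convert e5 using 2 with n
  rw [← e4 n, map_sub, map_sum]
  simp only [ContinuousLinearMap.comp_apply, sub_right_comm]

end Autoregressive

/-! ## Uniqueness of linear representations in a nondegenerate white noise -/

section Uniqueness

variable {H : Type*} [NormedAddCommGroup H] [InnerProductSpace ℂ H] [CompleteSpace H]
variable {Ω : Type*} [MeasurableSpace Ω] {P : Measure Ω} [IsProbabilityMeasure P]
variable {ε : ℤ → Ω → H}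

omit [CompleteSpace H] [IsProbabilityMeasure P] in
theorem IsWhiteNoise.crossCov_eq (hε : IsWhiteNoise P ε) (s t : ℤ) (h v : H) :
    crossCov P (ε s) (ε t) h v =
      ∫ ω, inner ℂ h (ε s ω) * starRingEnd ℂ (inner ℂ v (ε t ω)) ∂P := by
  simp only [crossCov, hε.mean_zero, sub_zero]

/-- Multiply the series by the conjugate of its m-th term and integrate: uncorrelatedness leaves
only the variance of that term, while the constant contributes 0 because the noise has mean zero.
Nondegeneracy then kills the m-th functional. -/
theorem IsNondegenerate.eq_zero_of_hasSum_const (hn : IsNondegenerate P ε) (hε : IsWhiteNoise P ε)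
    (hgr : HasPolynomialGrowth P ε) {f : ℕ → H →L[ℂ] ℂ} {F : ℂ → H →L[ℂ] ℂ}
    (hf : IsDiscSeries f F) {c : ℂ} {t : ℤ}
    (hc : ∀ᵐ ω ∂P, HasSum (fun n : ℕ => f n (ε (t - (n : ℤ)) ω)) c) (m : ℕ) : f m = 0 := by
  -- Riesz representatives turn the functionals into inner products, the form in which the
  -- covariance hypotheses are stated.
  set h : ℕ → H := fun n => (InnerProductSpace.toDual ℂ H).symm (f n) with hh
  have hfh : ∀ n v, f n v = inner ℂ (h n) v := fun n v => by simp [hh]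
  set g : ℕ → Ω → ℂ := fun n ω =>
    f n (ε (t - (n : ℤ)) ω) * starRingEnd ℂ (f m (ε (t - (m : ℤ)) ω)) with hg
  have hb : ∀ n ω, ‖g n ω‖ ≤
      ‖f n‖ * ‖f m‖ * (‖ε (t - (n : ℤ)) ω‖ ^ 2 + ‖ε (t - (m : ℤ)) ω‖ ^ 2) := fun n ω => by
    rw [hg]
    simp only [norm_mul, RCLike.norm_conj]
    calc _ ≤ (‖f n‖ * ‖ε (t - (n : ℤ)) ω‖) * (‖f m‖ * ‖ε (t - (m : ℤ)) ω‖) :=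
          mul_le_mul ((f n).le_opNorm _) ((f m).le_opNorm _) (norm_nonneg _) (by positivity)
      _ = ‖f n‖ * ‖f m‖ * (‖ε (t - (n : ℤ)) ω‖ * ‖ε (t - (m : ℤ)) ω‖) := by ring
      _ ≤ _ := by
        refine mul_le_mul_of_nonneg_left ?_ (by positivity)
        nlinarith [sq_nonneg (‖ε (t - (n : ℤ)) ω‖ - ‖ε (t - (m : ℤ)) ω‖),
          sq_nonneg (‖ε (t - (n : ℤ)) ω‖ + ‖ε (t - (m : ℤ)) ω‖)]
  have hbi : ∀ n, Integrable (fun ω =>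
      ‖f n‖ * ‖f m‖ * (‖ε (t - (n : ℤ)) ω‖ ^ 2 + ‖ε (t - (m : ℤ)) ω‖ ^ 2)) P := fun n =>
    ((hgr.integrable_norm_sq _).add (hgr.integrable_norm_sq _)).const_mul _
  have hgi : ∀ n, Integrable (g n) P := fun n => by
    refine (hbi n).mono' ?_ (Filter.Eventually.of_forall (hb n))
    exact ((f n).continuous.comp_aestronglyMeasurable (hgr.memLp _).1).mul
      (Complex.continuous_conj.comp_aestronglyMeasurable
        ((f m).continuous.comp_aestronglyMeasurable (hgr.memLp _).1))
  -- Summability in L¹ justifies integrating the product series term by term.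
  have hgs : Summable fun n => ∫ ω, ‖g n ω‖ ∂P := by
    refine Summable.of_nonneg_of_le (fun n => integral_nonneg fun ω => norm_nonneg _) (fun n => ?_)
      (((hgr.summable_norm_sq hf t).mul_left ‖f m‖).add
        (hf.one.2.mul_right (‖f m‖ * ∫ ω, ‖ε (t - (m : ℤ)) ω‖ ^ 2 ∂P)))
    refine (integral_mono (hgi n).norm (hbi n) (hb n)).trans_eq ?_
    rw [integral_const_mul, integral_add (hgr.integrable_norm_sq _) (hgr.integrable_norm_sq _)]
    ring
  have h1 := hasSum_integral_of_summable_integral_norm hgi hgs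
  have h2 : ∫ ω, ∑' n, g n ω ∂P = 0 := by
    have h3 : ∫ ω, ∑' n, g n ω ∂P = ∫ ω, c * starRingEnd ℂ (f m (ε (t - (m : ℤ)) ω)) ∂P := by
      refine integral_congr_ae ?_
      filter_upwards [hc] with ω hω using (hω.mul_right _).tsum_eq
    rw [h3, integral_const_mul, integral_conj, (f m).integral_comp_comm (hgr.integrable _),
      hε.mean_zero]
    simp
  have h4 : ∀ n, ∫ ω, g n ω ∂P = crossCov P (ε (t - (n : ℤ))) (ε (t - (m : ℤ))) (h n) (h m) := by
    intro n
    rw [hε.crossCov_eq]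
    simp only [hg, hfh]
  have h5 : HasSum (fun n => ∫ ω, g n ω ∂P) (∫ ω, g m ω ∂P) := by
    refine hasSum_single m fun n hnm => ?_
    rw [h4, hε.uncorrelated]
    intro h6
    exact hnm (by omega)
  rw [h2] at h1
  have h6 := h5.unique h1
  rw [h4] at h6
  by_contra hne
  refine hn _ (h m) ?_ h6
  intro h0
  refine hne ?_
  ext v
  rw [hfh, h0]
  simp

/-- Pairing with an arbitrary y reduces vector values to scalar ones. Constancy at a single time is
enough, since that one series involves every coefficient. -/
theorem IsNondegenerate.symbol_eq_zero {K : Type*} [NormedAddCommGroup K] [InnerProductSpace ℂ K]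
    [CompleteSpace K] (hn : IsNondegenerate P ε) (hε : IsWhiteNoise P ε)
    (hgr : HasPolynomialGrowth P ε) {F : ℂ → H →L[ℂ] K} {u : ℤ → Ω → K} (hu : HasSymbol P ε F u)
    {t : ℤ} {c : K} (hc : ∀ᵐ ω ∂P, u t ω = c) :
    ∃ ρ : ℝ, 1 < ρ ∧ ∀ z : ℂ, ‖z‖ < ρ → F z = 0 := by
  obtain ⟨B, hB, hBu⟩ := hu
  have h0 : ∀ n, B n = 0 := by
    intro n
    ext v
    refine ext_inner_left ℂ fun y => ?_
    have h1 := hn.eq_zero_of_hasSum_const hε hgr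
      (hB.map (ContinuousLinearMap.compL ℂ H K ℂ (innerSL ℂ y))) (c := inner ℂ y c) (t := t) ?_ n
    · have h2 := congrArg (fun T : H →L[ℂ] ℂ => T v) h1
      simpa using h2
    · filter_upwards [hBu t, hc] with ω h1 h2
      rw [← h2]
      simpa using h1.mapL (innerSL ℂ y)
  obtain ⟨ρ, hρ, h⟩ := hB
  refine ⟨ρ, hρ, fun z hz => ?_⟩
  have := (h z hz).2
  simp only [h0, smul_zero] at this
  exact this.unique hasSum_zero

end Uniqueness

/-! ## Expansions around the unit root -/

section Expansions

variable {E : Type*} [NormedAddCommGroup E] [NormedSpace ℂ E]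

omit [NormedSpace ℂ E] in
theorem eq_zero_of_eventually_eq_zero {g : ℂ → E} (hg : ContinuousAt g 1)
    (h : ∀ᶠ z in nhdsWithin (1 : ℂ) {1}ᶜ, g z = 0) : g 1 = 0 := by
  have h1 : Filter.Tendsto g (nhdsWithin (1 : ℂ) {1}ᶜ) (nhds (g 1)) :=
    hg.tendsto.mono_left nhdsWithin_le_nhds
  have h2 : Filter.Tendsto g (nhdsWithin (1 : ℂ) {1}ᶜ) (nhds 0) :=
    tendsto_const_nhds.congr' (h.mono fun z hz => hz.symm)
  exact tendsto_nhds_unique h1 h2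

/-- Let z tend to 1, divide by 1 - z, and repeat. Only continuity of the remainder is needed. -/
theorem coeff_eq_zero_of_eventually_eq_zero {c₀ c₁ : E} {g : ℂ → E} (hg : ContinuousAt g 1)
    (h : ∀ᶠ z in nhdsWithin (1 : ℂ) {1}ᶜ, c₀ + (1 - z) • c₁ + (1 - z) ^ 2 • g z = 0) :
    c₀ = 0 ∧ c₁ = 0 ∧ g 1 = 0 := by
  have hw : ContinuousAt (fun z : ℂ => 1 - z) 1 := by fun_prop
  have h0 : c₀ = 0 := by
    have := eq_zero_of_eventually_eq_zero
      (g := fun z => c₀ + (1 - z) • c₁ + (1 - z) ^ 2 • g z)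
      ((continuousAt_const.add (hw.smul continuousAt_const)).add ((hw.pow 2).smul hg)) h
    simpa using this
  have h1 : c₁ = 0 := by
    have := eq_zero_of_eventually_eq_zero (g := fun z => c₁ + (1 - z) • g z)
      (continuousAt_const.add (hw.smul hg)) (by
        filter_upwards [h, self_mem_nhdsWithin] with z hz hz1
        have h2 : (1 - z) ≠ 0 := sub_ne_zero.2 (Ne.symm hz1)
        refine (smul_eq_zero_iff_right h2).1 ?_
        rw [← hz, h0]
        module)
    simpa using this
  refine ⟨h0, h1, eq_zero_of_eventually_eq_zero hg ?_⟩
  filter_upwards [h, self_mem_nhdsWithin] with z hz hz1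
  have h2 : (1 - z) ^ 2 ≠ 0 := pow_ne_zero 2 (sub_ne_zero.2 (Ne.symm hz1))
  refine (smul_eq_zero_iff_right h2).1 ?_
  rw [← hz, h0, h1]
  module

theorem coeff_identities_of_mul_eq {R : Type*} [NormedRing R] [NormedAlgebra ℂ R]
    {x₀ x₁ y₀ y₁ : R} {x y : ℂ → R} (hx : ContinuousAt x 1) (hy : ContinuousAt y 1)
    (h : ∀ᶠ z in nhdsWithin (1 : ℂ) {1}ᶜ,
      (x₀ + (1 - z) • x₁ + (1 - z) ^ 2 • x z) * (y₀ + (1 - z) • y₁ + (1 - z) ^ 2 • y z) =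
        (1 - z) ^ 2 • (1 : R)) :
    x₀ * y₀ = 0 ∧ x₀ * y₁ + x₁ * y₀ = 0 ∧ x₀ * y 1 + x₁ * y₁ + x 1 * y₀ = 1 := by
  have hw : ContinuousAt (fun z : ℂ => 1 - z) 1 := by fun_prop
  -- The chosen remainder collects all terms of the product of order at least two, minus the
  -- identity on the right-hand side.
  have h1 := coeff_eq_zero_of_eventually_eq_zero (c₀ := x₀ * y₀) (c₁ := x₀ * y₁ + x₁ * y₀)
    (g := fun z => x₀ * y z + x₁ * y₁ + x z * y₀ - 1 + (1 - z) • (x₁ * y z + x z * y₁) +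
      (1 - z) ^ 2 • (x z * y z)) (by fun_prop) (by
        filter_upwards [h] with z hz
        rw [← sub_eq_zero] at hz
        rw [← hz]
        simp only [add_mul, mul_add, smul_mul_assoc, mul_smul_comm]
        module)
  obtain ⟨h2, h3, h4⟩ := h1
  refine ⟨h2, h3, ?_⟩
  simpa [sub_eq_zero] using h4

/-- A function differentiable on a disc has a second order Taylor expansion in powers
of `1 - z`. -/
theorem exists_taylor_two [CompleteSpace E] {F : ℂ → E} {ρ : ℝ} (hρ : 1 < ρ)
    (hF : DifferentiableOn ℂ F (Metric.ball 0 ρ)) :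
    ∃ (c : E) (g : ℂ → E), DifferentiableOn ℂ g (Metric.ball 0 ρ) ∧ c = -deriv F 1 ∧
      ∀ z, F z = F 1 + (1 - z) • c + (1 - z) ^ 2 • g z := by
  have h1 : Metric.ball (0 : ℂ) ρ ∈ nhds 1 := Metric.isOpen_ball.mem_nhds (by simpa using hρ)
  -- Two divided differences at 1 give the quadratic remainder; the sign comes from expanding in 1 -
  -- z instead of z - 1.
  refine ⟨-deriv F 1, dslope (dslope F 1) 1, ?_, rfl, fun z => ?_⟩
  · rw [Complex.differentiableOn_dslope h1, Complex.differentiableOn_dslope h1]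
    exact hF
  · have e1 := sub_smul_dslope F 1 z
    have e2 := sub_smul_dslope (dslope F 1) 1 z
    rw [dslope_same] at e2
    have e3 : (1 - z) ^ 2 • dslope (dslope F 1) 1 z =
        (z - 1) • (z - 1) • dslope (dslope F 1) 1 z := by
      rw [smul_smul]; congr 1; ring
    rw [e3, e2, smul_sub, e1]
    module

end Expansions

/-! ### Expansion of A(z) in powers of 1 - z. -/

section Tail

variable {H : Type*} [NormedAddCommGroup H] [InnerProductSpace ℂ H] (k : ℕ) (a : ℕ → H →L[ℂ] H)

/-- Binomial coefficients vanish for j < n, so one summation range serves all n and the sums over n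
and j can be exchanged. -/
theorem arCoeff_eq_sum (n : ℕ) :
    arCoeff k a n = (if n = 0 then 1 else 0) -
      (-1 : ℂ) ^ n • ∑ j ∈ Finset.Icc 1 k, (j.choose n : ℂ) • a j := by
  by_cases hn : n = 0
  · simp [arCoeff, hn]
  · rw [arCoeff, if_neg hn, if_neg hn, pow_succ, mul_neg_one, neg_smul, zero_sub]
    congr 2
    refine Finset.sum_subset (Finset.Icc_subset_Icc_left (Nat.one_le_iff_ne_zero.2 hn)) ?_
    intro j hj hj'
    rw [Finset.mem_Icc] at hj hj'
    rw [Nat.choose_eq_zero_of_lt (by omega)]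
    simp

theorem arCoeff_eq_zero {n : ℕ} (hn : k < n) : arCoeff k a n = 0 := by
  rw [arCoeff, if_neg (by omega), Finset.Icc_eq_empty (by omega)]
  simp

/-- The tails `∑ₙ (1 - z)^n A_{n+j}` of the expansion of `A(z)` around `z = 1`. -/
noncomputable def arTail (j : ℕ) (z : ℂ) : H →L[ℂ] H :=
  ∑ n ∈ Finset.range (k + 1), (1 - z) ^ n • arCoeff k a (n + j)

theorem arTail_succ (j : ℕ) (z : ℂ) :
    arTail k a j z = arCoeff k a j + (1 - z) • arTail k a (j + 1) z := by
  -- One extra term can be added for free because its coefficient has index above k; after the shift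
  -- the next tail has the same range.
  have h1 : arTail k a j z =
      ∑ n ∈ Finset.range (k + 1 + 1), (1 - z) ^ n • arCoeff k a (n + j) := by
    rw [Finset.sum_range_succ, arCoeff_eq_zero k a (n := k + 1 + j) (by omega)]
    simp [arTail]
  rw [h1, Finset.sum_range_succ', arTail, Finset.smul_sum, add_comm]
  simp only [pow_zero, one_smul, zero_add, smul_smul, pow_succ', add_assoc, add_comm 1 j]

/-- Write z = 1 - (1 - z), expand z^j by the binomial theorem and exchange the two finite sums. -/
theorem arTail_zero (z : ℂ) : arTail k a 0 z = arPoly k a z := by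
  have h1 : ∀ j ∈ Finset.Icc 1 k, z ^ j • a j =
      ∑ n ∈ Finset.range (k + 1), ((1 - z) ^ n * (-1) ^ n) • (j.choose n : ℂ) • a j := by
    intro j hj
    rw [Finset.mem_Icc] at hj
    have h2 : z ^ j = ∑ n ∈ Finset.range (j + 1), (1 - z) ^ n * (-1) ^ n * (j.choose n : ℂ) := by
      have := add_pow (-(1 - z)) 1 j
      rw [show -(1 - z) + 1 = z by ring] at this
      rw [this]
      refine Finset.sum_congr rfl fun n _ => ?_
      rw [one_pow, mul_one, neg_eq_neg_one_mul, mul_pow]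
      ring
    have h3 : z ^ j = ∑ n ∈ Finset.range (k + 1), (1 - z) ^ n * (-1) ^ n * (j.choose n : ℂ) := by
      rw [h2]
      refine Finset.sum_subset (Finset.range_subset_range.2 (by omega)) fun n _ hn => ?_
      rw [Finset.mem_range] at hn
      rw [Nat.choose_eq_zero_of_lt (by omega)]
      simp
    rw [h3, Finset.sum_smul]
    simp only [mul_smul]
  rw [arPoly, Finset.sum_congr rfl h1, Finset.sum_comm]
  simp only [arTail, add_zero, arCoeff_eq_sum, smul_sub, Finset.sum_sub_distrib]
  congr 1
  · rw [Finset.sum_eq_single 0 (fun n _ hn => by simp [hn]) (by simp)]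
    simp
  · simp only [Finset.smul_sum, smul_smul, mul_assoc]

theorem arPoly_eq (z : ℂ) : arPoly k a z =
    arCoeff k a 0 + (1 - z) • arCoeff k a 1 + (1 - z) ^ 2 • arTail k a 2 z := by
  rw [← arTail_zero, arTail_succ, arTail_succ, smul_add, smul_smul, ← sq]
  simp only [zero_add, one_add_one_eq_two, add_assoc]

theorem arPoly_one : arPoly k a 1 = arCoeff k a 0 := by
  rw [arPoly_eq]; simp

theorem arTail_one (j : ℕ) : arTail k a j 1 = arCoeff k a j := by
  rw [arTail_succ]; simp

theorem differentiable_arTail (j : ℕ) : Differentiable ℂ (arTail k a j) := by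
  unfold arTail
  fun_prop

theorem differentiable_arPoly : Differentiable ℂ (arPoly k a) := by
  unfold arPoly
  fun_prop

end Tail

/-! ## The subspaces `τ₀`, `τ₁`, `τ₂` -/

section Subspaces

variable {H : Type*} [NormedAddCommGroup H] [InnerProductSpace ℂ H] [CompleteSpace H]

-- The span of y and Im(R - 1) is finite dimensional and R-invariant, so injectivity gives
-- surjectivity on it, and y lies in it.
omit [CompleteSpace H] in
theorem surjective_of_injective_of_finiteDimensional_range_sub_one {R : H →L[ℂ] H}
    (hinj : Function.Injective R)
    [FiniteDimensional ℂ (R - 1).range] : Function.Surjective R := by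
  intro y
  set W : Submodule ℂ H := Submodule.span ℂ {y} ⊔ (R - 1).range with hW
  have hRW : ∀ w ∈ W, R w ∈ W := by
    intro w hw
    have h1 : R w = w + (R - 1) w := by simp
    rw [h1]
    exact W.add_mem hw (Submodule.mem_sup_right ⟨w, rfl⟩)
  let f : W →ₗ[ℂ] W := (R : H →ₗ[ℂ] H).restrict hRW
  have hf : Function.Injective f := by
    intro u v huv
    exact Subtype.ext (hinj (congrArg Subtype.val huv))
  obtain ⟨u, hu⟩ := LinearMap.surjective_of_injective hf
    ⟨y, Submodule.mem_sup_left (Submodule.mem_span_singleton_self y)⟩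
  exact ⟨u, congrArg Subtype.val hu⟩

variable {k : ℕ} {a : ℕ → H →L[ℂ] H}

omit [CompleteSpace H] in
theorem HasUnitRootOfFiniteType.isClosed_range (hA : HasUnitRootOfFiniteType k a) :
    IsClosed ((arCoeff k a 0).range : Set H) := by
  rw [← arPoly_one]
  exact hA.fredholm.isClosed_range

omit [CompleteSpace H] in
theorem HasUnitRootOfFiniteType.finiteDimensional_ker (hA : HasUnitRootOfFiniteType k a) :
    FiniteDimensional ℂ (arCoeff k a 0).ker := by
  rw [← arPoly_one]
  exact hA.fredholm.finite_ker

theorem HasUnitRootOfFiniteType.isGeneralizedInverse (hA : HasUnitRootOfFiniteType k a) :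
    IsGeneralizedInverse (arCoeff k a 0) (generalizedInverse (arCoeff k a 0)) :=
  generalizedInverse_spec hA.isClosed_range

/-! ### Action of the generalized inverse on vectors. -/

section GeneralizedInverse

variable {A G : H →L[ℂ] H} (hG : IsGeneralizedInverse A G)
include hG

theorem IsGeneralizedInverse.apply_of_mem_range {y : H} (hy : y ∈ A.range) : A (G y) = y := by
  obtain ⟨v, rfl⟩ := hy
  exact congrArg (fun T : H →L[ℂ] H => T v) hG.mul_mul

theorem IsGeneralizedInverse.apply_mem (y : H) : G y ∈ A.kerᗮ := by
  have h1 : G y = (G * A) (G y) :=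
    (congrArg (fun T : H →L[ℂ] H => T y) hG.mul_mul_inv).symm
  rw [h1, Submodule.mem_orthogonal]
  intro u hu
  have h2 : A u = 0 := hu
  have h3 := hG.right_selfAdjoint.isSymmetric u (G y)
  change inner ℂ ((G * A) u) (G y) = inner ℂ u ((G * A) (G y)) at h3
  rw [← h3]
  simp [h2]

theorem IsGeneralizedInverse.apply_apply_of_mem {y : H} (hy : y ∈ A.kerᗮ) : G (A y) = y := by
  have h1 : y - G (A y) ∈ A.ker ⊓ A.kerᗮ := by
    refine ⟨?_, Submodule.sub_mem _ hy (hG.apply_mem _)⟩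
    change A (y - G (A y)) = 0
    rw [map_sub, hG.apply_of_mem_range (y := A y) ⟨y, rfl⟩, sub_self]
  rw [Submodule.inf_orthogonal_eq_bot, Submodule.mem_bot, sub_eq_zero] at h1
  exact h1.symm

theorem IsGeneralizedInverse.inner_apply_apply {v : H} (hv : v ∈ A.kerᗮ) (y : H) :
    inner ℂ v (G (A y)) = inner ℂ v y := by
  have h3 := hG.right_selfAdjoint.isSymmetric v y
  change inner ℂ (G (A v)) y = inner ℂ v (G (A y)) at h3
  rw [← h3, hG.apply_apply_of_mem hv]

end GeneralizedInverse

instance : (tau0 k a).HasOrthogonalProjection := by unfold tau0; infer_instance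
instance : (tau1 k a).HasOrthogonalProjection := by unfold tau1; infer_instance

theorem tau0_orthogonal : (tau0 k a)ᗮ = (arCoeff k a 0).ker := by
  have := (arCoeff k a 0).isClosed_ker.completeSpace_coe
  exact Submodule.orthogonal_orthogonal _

theorem tau1_orthogonal : (tau1 k a)ᗮ = (S1 k a).ker := by
  have := (S1 k a).isClosed_ker.completeSpace_coe
  exact Submodule.orthogonal_orthogonal _

theorem S1_apply_of_mem_tau0 {v : H} (hv : v ∈ tau0 k a) : S1 k a v = 0 := by
  have h1 : (tau0 k a)ᗮ.starProjection v = 0 := by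
    rw [Submodule.starProjection_apply_eq_zero_iff]
    exact Submodule.le_orthogonal_orthogonal _ hv
  simp [S1, h1]

theorem S1_apply_of_mem_ker {v : H} (hv : arCoeff k a 0 v = 0) :
    S1 k a v = (zeta0 k a)ᗮ.starProjection (arCoeff k a 1 v) := by
  have h1 : (tau0 k a)ᗮ.starProjection v = v := by
    rw [Submodule.starProjection_eq_self_iff, tau0_orthogonal]
    exact hv
  simp [S1, h1]

/-- Automatic, because S₁ begins with the projection that kills τ₀. -/
theorem tau0_isOrtho_tau1 : tau0 k a ⟂ tau1 k a := by
  rw [Submodule.isOrtho_iff_le]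
  intro v hv
  rw [tau1_orthogonal]
  exact S1_apply_of_mem_tau0 hv

theorem tau1_le : tau1 k a ≤ (tau0 k a)ᗮ := by
  have h := (tau0_isOrtho_tau1 (k := k) (a := a)).symm
  rwa [Submodule.isOrtho_iff_le] at h

theorem arCoeff_zero_apply_of_mem_tau1 {v : H} (hv : v ∈ tau1 k a) : arCoeff k a 0 v = 0 := by
  have := tau1_le hv
  rwa [tau0_orthogonal] at this

theorem mem_orthogonal_sup_iff {v : H} :
    v ∈ (tau0 k a ⊔ tau1 k a)ᗮ ↔ arCoeff k a 0 v = 0 ∧ S1 k a v = 0 := by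
  rw [← Submodule.inf_orthogonal, Submodule.mem_inf, tau0_orthogonal, tau1_orthogonal]
  rfl

theorem HasUnitRootOfFiniteType.orthogonal_zeta0 (hA : HasUnitRootOfFiniteType k a) :
    (zeta0 k a)ᗮᗮ = zeta0 k a := by
  have h : IsClosed (zeta0 k a : Set H) := hA.isClosed_range
  have := h.completeSpace_coe
  exact Submodule.orthogonal_orthogonal _

theorem HasUnitRootOfFiniteType.arCoeff_one_sub_S1_mem (hA : HasUnitRootOfFiniteType k a) {v : H}
    (hv : arCoeff k a 0 v = 0) : arCoeff k a 1 v - S1 k a v ∈ zeta0 k a := by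
  rw [S1_apply_of_mem_ker hv]
  have h := Submodule.sub_starProjection_mem_orthogonal (K := (zeta0 k a)ᗮ) (arCoeff k a 1 v)
  rwa [hA.orthogonal_zeta0] at h

/-- This makes A₀A₀⁺A₁v = A₁v valid on (τ₀⊕τ₁)^⊥, the cancellation behind A_{2,1}. -/
theorem HasUnitRootOfFiniteType.arCoeff_one_mem (hA : HasUnitRootOfFiniteType k a) {v : H}
    (hv : v ∈ (tau0 k a ⊔ tau1 k a)ᗮ) : arCoeff k a 1 v ∈ zeta0 k a := by
  rw [mem_orthogonal_sup_iff] at hv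
  have := hA.arCoeff_one_sub_S1_mem hv.1
  rwa [hv.2, sub_zero] at this

theorem HasUnitRootOfFiniteType.finiteDimensional_orthogonal_tau0
    (hA : HasUnitRootOfFiniteType k a) : FiniteDimensional ℂ (tau0 k a)ᗮ := by
  rw [tau0_orthogonal]
  exact hA.finiteDimensional_ker

theorem HasUnitRootOfFiniteType.finiteDimensional_tau1 (hA : HasUnitRootOfFiniteType k a) :
    FiniteDimensional ℂ (tau1 k a) := by
  have := hA.finiteDimensional_orthogonal_tau0
  exact Submodule.finiteDimensional_of_le tau1_le

theorem HasUnitRootOfFiniteType.isClosed_sup (hA : HasUnitRootOfFiniteType k a) :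
    IsClosed ((tau0 k a ⊔ tau1 k a : Submodule ℂ H) : Set H) := by
  have := hA.finiteDimensional_tau1
  exact Submodule.isClosed_sup_finiteDimensional _ _ (Submodule.isClosed_orthogonal _)

theorem HasUnitRootOfFiniteType.orthogonal_orthogonal_sup (hA : HasUnitRootOfFiniteType k a) :
    (tau0 k a ⊔ tau1 k a)ᗮᗮ = tau0 k a ⊔ tau1 k a := by
  have := hA.isClosed_sup.completeSpace_coe
  exact Submodule.orthogonal_orthogonal _

/-- The orthogonal complement of Ker S₁ is the closure of Im S₁*, and the closure is superfluous
because τ₁ is finite dimensional. -/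
theorem HasUnitRootOfFiniteType.exists_mem_tau1_eq (hA : HasUnitRootOfFiniteType k a) {v : H}
    (hv : v ∈ tau1 k a) : ∃ h : H, v = ContinuousLinearMap.adjoint (S1 k a) h := by
  have h1 : tau1 k a = (ContinuousLinearMap.adjoint (S1 k a)).range.topologicalClosure :=
    (S1 k a).orthogonal_ker
  have := hA.finiteDimensional_tau1
  have : FiniteDimensional ℂ (ContinuousLinearMap.adjoint (S1 k a)).range :=
    Submodule.finiteDimensional_of_le
      (S₂ := tau1 k a) (h1 ▸ Submodule.le_topologicalClosure _)
  rw [h1, (Submodule.closed_of_finiteDimensional _).submodule_topologicalClosure_eq] at hv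
  obtain ⟨h, rfl⟩ := hv
  exact ⟨h, rfl⟩

theorem S2_apply_of_mem_sup {v : H} (hv : v ∈ tau0 k a ⊔ tau1 k a) : S2 k a v = 0 := by
  have h1 : (tau0 k a ⊔ tau1 k a)ᗮ.starProjection v = 0 := by
    rw [Submodule.starProjection_apply_eq_zero_iff]
    exact Submodule.le_orthogonal_orthogonal _ hv
  simp [S2, h1]

theorem S2_apply_of_mem {v : H} (hv : v ∈ (tau0 k a ⊔ tau1 k a)ᗮ) :
    S2 k a v = (zeta0 k a ⊔ zeta1 k a)ᗮ.starProjection (arCoeff21 k a v) := by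
  have h1 : (tau0 k a ⊔ tau1 k a)ᗮ.starProjection v = v :=
    Submodule.starProjection_eq_self_iff.2 hv
  simp [S2, h1]

theorem tau2_le : tau2 k a ≤ (tau0 k a ⊔ tau1 k a)ᗮ :=
  Submodule.orthogonal_le fun _ hv => S2_apply_of_mem_sup hv

/-- `S₂` is injective on `(τ₀ ⊕ τ₁)^⊥` if and only if `τ₂` is all of it. -/
theorem HasUnitRootOfFiniteType.tau2_eq_iff (hA : HasUnitRootOfFiniteType k a) :
    tau2 k a = (tau0 k a ⊔ tau1 k a)ᗮ ↔
      ∀ v ∈ (tau0 k a ⊔ tau1 k a)ᗮ, S2 k a v = 0 → v = 0 := by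
  constructor
  · intro h v hv hSv
    have h1 : v ∈ (S2 k a).ker ⊓ (S2 k a).kerᗮ := ⟨hSv, by rw [← h] at hv; exact hv⟩
    rwa [Submodule.inf_orthogonal_eq_bot, Submodule.mem_bot] at h1
  · intro h
    refine le_antisymm tau2_le (Submodule.orthogonal_le fun v hv => ?_)
    have := hA.isClosed_sup.completeSpace_coe
    set q := (tau0 k a ⊔ tau1 k a).starProjection v with hq
    have h1 : v - q ∈ (tau0 k a ⊔ tau1 k a)ᗮ := Submodule.sub_starProjection_mem_orthogonal v
    have h2 : q ∈ tau0 k a ⊔ tau1 k a := Submodule.starProjection_apply_mem _ v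
    have h3 : S2 k a (v - q) = 0 := by
      rw [map_sub, S2_apply_of_mem_sup h2, sub_zero]; exact hv
    have h4 := h _ h1 h3
    rw [sub_eq_zero] at h4
    rw [h4]; exact h2

/-- All orthogonality relations hold by construction, so the real content of the decomposition is
that τ₂ fills the whole complement of τ₀⊕τ₁ and that this complement is nontrivial. -/
theorem HasUnitRootOfFiniteType.poleTwoCondition_iff (hA : HasUnitRootOfFiniteType k a) :
    PoleTwoCondition k a ↔
      (∀ v ∈ (tau0 k a ⊔ tau1 k a)ᗮ, S2 k a v = 0 → v = 0) ∧ (tau0 k a ⊔ tau1 k a)ᗮ ≠ ⊥ := by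
  rw [← hA.tau2_eq_iff]
  constructor
  · intro h
    have h1 : tau2 k a = (tau0 k a ⊔ tau1 k a)ᗮ := by
      refine le_antisymm tau2_le fun v hv => ?_
      have h2 : v ∈ tau0 k a ⊔ tau1 k a ⊔ tau2 k a := by rw [h.sup_eq_top]; trivial
      obtain ⟨p, hp, q, hq, rfl⟩ := Submodule.mem_sup.1 h2
      have h3 : p ∈ (tau0 k a ⊔ tau1 k a) ⊓ (tau0 k a ⊔ tau1 k a)ᗮ := by
        refine ⟨hp, ?_⟩
        have := Submodule.sub_mem _ hv (tau2_le hq)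
        rwa [add_sub_cancel_right] at this
      rw [Submodule.inf_orthogonal_eq_bot, Submodule.mem_bot] at h3
      rw [h3, zero_add]
      exact hq
    exact ⟨h1, h1 ▸ h.ne_bot⟩
  · rintro ⟨h1, h2⟩
    have h3 := tau2_le (k := k) (a := a)
    have := hA.isClosed_sup.completeSpace_coe
    refine ⟨tau0_isOrtho_tau1, ?_, ?_, ?_, h1 ▸ h2⟩
    · exact (Submodule.isOrtho_iff_le.2
        (h3.trans (Submodule.orthogonal_le le_sup_left))).symm
    · exact (Submodule.isOrtho_iff_le.2
        (h3.trans (Submodule.orthogonal_le le_sup_right))).symm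
    · rw [h1, Submodule.sup_orthogonal_of_hasOrthogonalProjection]

end Subspaces

/-! ## The pole of second order -/

section Pole

variable {H : Type*} [NormedAddCommGroup H] [InnerProductSpace ℂ H] [CompleteSpace H]
variable {k : ℕ} {a : ℕ → H →L[ℂ] H}

/-- The projection onto `(τ₀ ⊕ τ₁)^⊥` along the orthogonal sum `τ₀ ⊕ τ₁`. -/
noncomputable def proj2 (k : ℕ) (a : ℕ → H →L[ℂ] H) : H →L[ℂ] H :=
  1 - (tau0 k a).starProjection - (tau1 k a).starProjection

theorem add_proj2 (v : H) :
    (tau0 k a).starProjection v + (tau1 k a).starProjection v + proj2 k a v = v := by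
  simp [proj2]

theorem proj1_of_mem_tau0 {v : H} (hv : v ∈ tau0 k a) : (tau1 k a).starProjection v = 0 := by
  rw [Submodule.starProjection_apply_eq_zero_iff]
  exact Submodule.isOrtho_iff_le.1 tau0_isOrtho_tau1 hv

theorem proj0_of_mem_tau1 {v : H} (hv : v ∈ tau1 k a) : (tau0 k a).starProjection v = 0 := by
  rw [Submodule.starProjection_apply_eq_zero_iff]
  exact tau1_le hv

theorem proj2_of_mem_tau0 {v : H} (hv : v ∈ tau0 k a) : proj2 k a v = 0 := by
  have h := add_proj2 (k := k) (a := a) v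
  rw [proj1_of_mem_tau0 hv, Submodule.starProjection_eq_self_iff.2 hv] at h
  simpa using h

theorem proj2_of_mem_tau1 {v : H} (hv : v ∈ tau1 k a) : proj2 k a v = 0 := by
  have h := add_proj2 (k := k) (a := a) v
  rw [proj0_of_mem_tau1 hv, Submodule.starProjection_eq_self_iff.2 hv] at h
  simpa using h

theorem proj2_of_mem {v : H} (hv : v ∈ (tau0 k a ⊔ tau1 k a)ᗮ) : proj2 k a v = v := by
  rw [← Submodule.inf_orthogonal, Submodule.mem_inf] at hv
  have h := add_proj2 (k := k) (a := a) v
  rw [(Submodule.starProjection_apply_eq_zero_iff _).2 hv.1,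
    (Submodule.starProjection_apply_eq_zero_iff _).2 hv.2] at h
  simpa using h

theorem proj2_mem (v : H) : proj2 k a v ∈ (tau0 k a ⊔ tau1 k a)ᗮ := by
  rw [← Submodule.inf_orthogonal, Submodule.mem_inf]
  have h0 : (tau0 k a).starProjection v ∈ tau0 k a := Submodule.starProjection_apply_mem _ v
  have h1 : (tau1 k a).starProjection v ∈ tau1 k a := Submodule.starProjection_apply_mem _ v
  constructor
  · exact Submodule.sub_mem _ (Submodule.sub_starProjection_mem_orthogonal v) (tau1_le h1)
  · have h2 : proj2 k a v = (v - (tau1 k a).starProjection v) - (tau0 k a).starProjection v := by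
      simp [proj2, sub_right_comm]
    rw [h2]
    exact Submodule.sub_mem _ (Submodule.sub_starProjection_mem_orthogonal v)
      (Submodule.isOrtho_iff_le.1 tau0_isOrtho_tau1 h0)

/-- The operator `A₀ + A₁ P_{τ₁} + A_{2,1} P_{(τ₀ ⊕ τ₁)^⊥}`. -/
noncomputable def pivot (k : ℕ) (a : ℕ → H →L[ℂ] H) : H →L[ℂ] H :=
  arCoeff k a 0 + arCoeff k a 1 * (tau1 k a).starProjection + arCoeff21 k a * proj2 k a

theorem pivot_of_mem_tau0 {v : H} (hv : v ∈ tau0 k a) : pivot k a v = arCoeff k a 0 v := by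
  simp [pivot, proj1_of_mem_tau0 hv, proj2_of_mem_tau0 hv]

theorem pivot_of_mem_tau1 {v : H} (hv : v ∈ tau1 k a) : pivot k a v = arCoeff k a 1 v := by
  simp [pivot, Submodule.starProjection_eq_self_iff.2 hv, proj2_of_mem_tau1 hv,
    arCoeff_zero_apply_of_mem_tau1 hv]

/-- The operator is block triangular: modulo the closure of ζ₀⊕ζ₁ only S₂ on the third component
survives, then modulo ζ₀ only S₁ on the second, and finally A₀ on the first. Each block is
injective. -/
theorem HasUnitRootOfFiniteType.pivot_injective (hA : HasUnitRootOfFiniteType k a)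
    (hS : ∀ v ∈ (tau0 k a ⊔ tau1 k a)ᗮ, S2 k a v = 0 → v = 0) :
    Function.Injective (pivot k a) := by
  rw [injective_iff_map_eq_zero]
  intro v hv
  obtain ⟨v0, hv0⟩ : ∃ w, w = (tau0 k a).starProjection v := ⟨_, rfl⟩
  obtain ⟨v1, hv1⟩ : ∃ w, w = (tau1 k a).starProjection v := ⟨_, rfl⟩
  obtain ⟨v2, hv2⟩ : ∃ w, w = proj2 k a v := ⟨_, rfl⟩
  have hsum : v0 + v1 + v2 = v := by rw [hv0, hv1, hv2, add_proj2]
  have m0 : v0 ∈ tau0 k a := hv0 ▸ Submodule.starProjection_apply_mem _ v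
  have m1 : v1 ∈ tau1 k a := hv1 ▸ Submodule.starProjection_apply_mem _ v
  have m2 : v2 ∈ (tau0 k a ⊔ tau1 k a)ᗮ := hv2 ▸ proj2_mem v
  have hM : arCoeff k a 0 v0 + arCoeff k a 1 v1 + arCoeff21 k a v2 = 0 := by
    have h1 : arCoeff k a 0 v = arCoeff k a 0 v0 := by
      rw [← hsum, map_add, map_add, arCoeff_zero_apply_of_mem_tau1 m1,
        (mem_orthogonal_sup_iff.1 m2).1, add_zero, add_zero]
    rw [← h1, ← hv, hv1, hv2]
    simp [pivot]
  have a0 : arCoeff k a 0 v0 ∈ zeta0 k a := ⟨v0, rfl⟩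
  have k1 := arCoeff_zero_apply_of_mem_tau1 m1
  have a1 := hA.arCoeff_one_sub_S1_mem k1
  have s1 : S1 k a v1 ∈ zeta1 k a := ⟨v1, rfl⟩
  have e2 : v2 = 0 := by
    refine hS v2 m2 ?_
    rw [S2_apply_of_mem m2, Submodule.starProjection_apply_eq_zero_iff]
    refine Submodule.le_orthogonal_orthogonal _ ?_
    have h3 : arCoeff21 k a v2 =
        -(arCoeff k a 0 v0 + (arCoeff k a 1 v1 - S1 k a v1)) + -(S1 k a v1) := by
      rw [eq_neg_of_add_eq_zero_right hM]
      abel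
    rw [h3]
    exact Submodule.add_mem_sup (Submodule.neg_mem _ (Submodule.add_mem _ a0 a1))
      (Submodule.neg_mem _ s1)
  rw [e2, map_zero, add_zero] at hM
  have e1 : v1 = 0 := by
    have h4 : S1 k a v1 = 0 := by
      rw [S1_apply_of_mem_ker k1, Submodule.starProjection_apply_eq_zero_iff]
      refine Submodule.le_orthogonal_orthogonal _ ?_
      rw [eq_neg_of_add_eq_zero_right hM]
      exact Submodule.neg_mem _ a0
    have h5 : v1 ∈ (S1 k a).ker ⊓ (S1 k a).kerᗮ := ⟨h4, m1⟩
    rwa [Submodule.inf_orthogonal_eq_bot, Submodule.mem_bot] at h5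
  rw [e1, map_zero, add_zero] at hM
  have e0 : v0 = 0 := by
    have h5 : v0 ∈ (arCoeff k a 0).ker ⊓ (arCoeff k a 0).kerᗮ := ⟨hM, m0⟩
    rwa [Submodule.inf_orthogonal_eq_bot, Submodule.mem_bot] at h5
  rw [← hsum, e0, e1, e2]
  simp

/-- There is an invertible operator which agrees with `A₀` on `τ₀`. -/
theorem HasUnitRootOfFiniteType.exists_isUnit_eq (hA : HasUnitRootOfFiniteType k a) :
    ∃ T : H →L[ℂ] H, IsUnit T ∧ ∀ v ∈ tau0 k a, T v = arCoeff k a 0 v := by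
  obtain ⟨ρ, hρ, hinv⟩ := hA.invertible
  set G := generalizedInverse (arCoeff k a 0) with hG
  have hcont : Filter.Tendsto (fun z => ‖(arCoeff k a 0 - arPoly k a z) * G‖)
      (nhdsWithin (1 : ℂ) {1}ᶜ) (nhds 0) := by
    have h1 : Continuous fun z => ‖(arCoeff k a 0 - arPoly k a z) * G‖ := by
      have := (differentiable_arPoly k a).continuous
      fun_prop
    have h2 := h1.tendsto 1
    rw [arPoly_one, sub_self, zero_mul, norm_zero] at h2
    exact h2.mono_left nhdsWithin_le_nhds
  have hball : ∀ᶠ z in nhdsWithin (1 : ℂ) {1}ᶜ, ‖z‖ < ρ :=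
    nhdsWithin_le_nhds (continuous_norm.continuousAt.eventually_lt continuousAt_const
      (by simpa using hρ))
  obtain ⟨z, hz1, hz2, hz3⟩ :=
    ((hcont.eventually_lt_const zero_lt_one).and (hball.and self_mem_nhdsWithin)).exists
  -- For z close to 1 the factor U = 1 - (A₀ - A(z))G is invertible by a Neumann series, and UA₀ =
  -- A(z) on τ₀ since GA₀ is the identity there. Invertibility of A(z) thus replaces an index
  -- argument.
  have hu := isUnit_one_sub_of_norm_lt_one hz1
  obtain ⟨U, hU⟩ := hu
  refine ⟨↑U⁻¹ * arPoly k a z, U⁻¹.isUnit.mul (hinv z hz2 hz3), fun v hv => ?_⟩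
  have h1 : (U : H →L[ℂ] H) (arCoeff k a 0 v) = arPoly k a z v := by
    have h2 : G (arCoeff k a 0 v) = v := hA.isGeneralizedInverse.apply_apply_of_mem hv
    rw [hU]
    simp [h2]
  rw [mul_apply_eq_comp, ← h1, ← mul_apply_eq_comp, Units.inv_mul]
  simp

/-- After division by an invertible operator that equals A₀ on τ₀, the pivot becomes the identity on
τ₀. As τ₀ has finite codimension, it is a finite-rank perturbation of the identity, for which
injectivity implies bijectivity. -/
theorem HasUnitRootOfFiniteType.isUnit_pivot (hA : HasUnitRootOfFiniteType k a)
    (hS : ∀ v ∈ (tau0 k a ⊔ tau1 k a)ᗮ, S2 k a v = 0 → v = 0) : IsUnit (pivot k a) := by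
  obtain ⟨T, ⟨U, rfl⟩, hT⟩ := hA.exists_isUnit_eq
  have hinj := hA.pivot_injective hS
  set R : H →L[ℂ] H := ↑U⁻¹ * pivot k a with hR
  have hUR : (U : H →L[ℂ] H) * R = pivot k a := by simp [hR]
  have hRinj : Function.Injective R := by
    have h1 : Function.Injective ((U : H →L[ℂ] H) * R) := by rw [hUR]; exact hinj
    exact Function.Injective.of_comp (f := (U : H →L[ℂ] H)) h1
  have hR0 : ∀ v ∈ tau0 k a, (R - 1) v = 0 := by
    intro v hv
    rw [hR, sub_apply, mul_apply_eq_comp, pivot_of_mem_tau0 hv,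
      ← hT v hv, ← mul_apply_eq_comp, Units.inv_mul, sub_self]
  have hfin : FiniteDimensional ℂ (R - 1).range := by
    have := hA.finiteDimensional_orthogonal_tau0
    refine Submodule.finiteDimensional_of_le
      (S₂ := (tau0 k a)ᗮ.map ((R - 1 : H →L[ℂ] H) : H →ₗ[ℂ] H)) ?_
    rintro _ ⟨v, rfl⟩
    refine ⟨v - (tau0 k a).starProjection v, Submodule.sub_starProjection_mem_orthogonal v, ?_⟩
    have h1 := hR0 _ (Submodule.starProjection_apply_mem (tau0 k a) v)
    change (R - 1) (v - _) = (R - 1) v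
    rw [map_sub, h1, sub_zero]
  have hRsurj := surjective_of_injective_of_finiteDimensional_range_sub_one hRinj
  have hRu : IsUnit R := ContinuousLinearMap.isUnit_iff_bijective.2 ⟨hRinj, hRsurj⟩
  rw [← hUR]
  exact U.isUnit.mul hRu

/-- The polynomial `(1 - z)² P_{τ₀} + (1 - z) P_{τ₁} + (1 - (1 - z) A₀⁺ A₁) P_{(τ₀ ⊕ τ₁)^⊥}`. -/
noncomputable def rightFactor (k : ℕ) (a : ℕ → H →L[ℂ] H) (z : ℂ) : H →L[ℂ] H :=
  (1 - z) ^ 2 • (tau0 k a).starProjection + (1 - z) • (tau1 k a).starProjection + proj2 k a -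
    (1 - z) • (generalizedInverse (arCoeff k a 0) * arCoeff k a 1 * proj2 k a)

/-- `pivot + (1 - z) R(z)` with `A(z) * rightFactor z = (1 - z)² (pivot + (1 - z) R(z))`. -/
noncomputable def regularFactor (k : ℕ) (a : ℕ → H →L[ℂ] H) (z : ℂ) : H →L[ℂ] H :=
  pivot k a + (1 - z) • (arTail k a 1 z * (tau0 k a).starProjection +
    arTail k a 2 z * (tau1 k a).starProjection + arTail k a 3 z * proj2 k a -
    arTail k a 2 z * (generalizedInverse (arCoeff k a 0) * arCoeff k a 1 * proj2 k a))

/-- On τ₀ the right factor supplies both powers of 1 - z; on τ₁ it supplies one and A₀ = 0 the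
other. On the complement A₀ = 0 removes order zero, and the correction by A₀⁺A₁ cancels order one
and changes A₂ into A_{2,1} at order two. -/
theorem HasUnitRootOfFiniteType.arPoly_mul_rightFactor (hA : HasUnitRootOfFiniteType k a) (z : ℂ) :
    arPoly k a z * rightFactor k a z = (1 - z) ^ 2 • regularFactor k a z := by
  ext v
  obtain ⟨v0, hv0⟩ : ∃ w, w = (tau0 k a).starProjection v := ⟨_, rfl⟩
  obtain ⟨v1, hv1⟩ : ∃ w, w = (tau1 k a).starProjection v := ⟨_, rfl⟩
  obtain ⟨v2, hv2⟩ : ∃ w, w = proj2 k a v := ⟨_, rfl⟩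
  have hsum : v0 + v1 + v2 = v := by rw [hv0, hv1, hv2, add_proj2]
  have m0 : v0 ∈ tau0 k a := hv0 ▸ Submodule.starProjection_apply_mem _ v
  have m1 : v1 ∈ tau1 k a := hv1 ▸ Submodule.starProjection_apply_mem _ v
  have m2 : v2 ∈ (tau0 k a ⊔ tau1 k a)ᗮ := hv2 ▸ proj2_mem v
  obtain ⟨g, hg⟩ : ∃ g, g = generalizedInverse (arCoeff k a 0) (arCoeff k a 1 v2) := ⟨_, rfl⟩
  have eg : arCoeff k a 0 g = arCoeff k a 1 v2 := by
    rw [hg]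
    exact hA.isGeneralizedInverse.apply_of_mem_range (hA.arCoeff_one_mem m2)
  have k1 := arCoeff_zero_apply_of_mem_tau1 m1
  have k2 := (mem_orthogonal_sup_iff.1 m2).1
  have k0 : arCoeff k a 0 v = arCoeff k a 0 v0 := by
    rw [← hsum, map_add, map_add, k1, k2, add_zero, add_zero]
  have t0 : ∀ u, arPoly k a z u = arCoeff k a 0 u + (1 - z) • arTail k a 1 z u := fun u => by
    rw [← arTail_zero, arTail_succ]; simp
  have t1 : ∀ u, arTail k a 1 z u = arCoeff k a 1 u + (1 - z) • arTail k a 2 z u := fun u => by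
    rw [arTail_succ]; simp
  have t2 : ∀ u, arTail k a 2 z u = arCoeff k a 2 u + (1 - z) • arTail k a 3 z u := fun u => by
    rw [arTail_succ]; simp
  have f1 : rightFactor k a z v = (1 - z) ^ 2 • v0 + (1 - z) • v1 + v2 - (1 - z) • g := by
    simp [rightFactor, hv0, hv1, hv2, hg]
  have f2 : regularFactor k a z v = arCoeff k a 0 v0 + arCoeff k a 1 v1 +
      (arCoeff k a 2 v2 - arCoeff k a 1 g) + (1 - z) • (arTail k a 1 z v0 +
        arTail k a 2 z v1 + arTail k a 3 z v2 - arTail k a 2 z g) := by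
    simp [regularFactor, pivot, arCoeff21, ← hv0, ← hv1, ← hv2, ← hg, k0]
  rw [mul_apply_eq_comp, smul_apply, f1, f2]
  simp only [map_add, map_sub, map_smul]
  rw [t0 v0, t0 v1, t0 v2, t0 g, k1, k2, eg, t1 v1, t1 v2, t1 g, t2 v2]
  module

theorem rightFactor_one : rightFactor k a 1 = proj2 k a := by
  simp [rightFactor]

theorem regularFactor_one : regularFactor k a 1 = pivot k a := by
  simp [regularFactor]

theorem differentiable_rightFactor : Differentiable ℂ (rightFactor k a) := by
  unfold rightFactor
  fun_prop

theorem differentiable_regularFactor : Differentiable ℂ (regularFactor k a) := by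
  have h1 := differentiable_arTail k a 1
  have h2 := differentiable_arTail k a 2
  have h3 := differentiable_arTail k a 3
  unfold regularFactor
  fun_prop

/-- Under the pole condition, `(1 - z)² A(z)⁻¹` extends to a differentiable function on a disc of
radius larger than `1`, with explicit value at `z = 1`. -/
theorem HasUnitRootOfFiniteType.exists_regular_inverse (hA : HasUnitRootOfFiniteType k a)
    (hS : ∀ v ∈ (tau0 k a ⊔ tau1 k a)ᗮ, S2 k a v = 0 → v = 0) :
    ∃ (F : ℂ → H →L[ℂ] H) (ρ : ℝ), 1 < ρ ∧ DifferentiableOn ℂ F (Metric.ball 0 ρ) ∧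
      (∀ z : ℂ, ‖z‖ < ρ → z ≠ 1 → IsUnit (arPoly k a z)) ∧
      (∀ z, z ≠ 1 → F z = (1 - z) ^ 2 • Ring.inverse (arPoly k a z)) ∧
      F 1 * pivot k a = proj2 k a := by
  obtain ⟨ρ, hρ, hinv⟩ := hA.invertible
  have hM := hA.isUnit_pivot hS
  -- The value inserted at the removable singularity is the one dictated by the factorization at z =
  -- 1.
  set F : ℂ → H →L[ℂ] H := Function.update
    (fun z => (1 - z) ^ 2 • Ring.inverse (arPoly k a z)) 1
    (proj2 k a * Ring.inverse (pivot k a)) with hF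
  have hF1 : F 1 = proj2 k a * Ring.inverse (pivot k a) := by simp [hF]
  have hFz : ∀ z, z ≠ 1 → F z = (1 - z) ^ 2 • Ring.inverse (arPoly k a z) := fun z hz => by
    simp [hF, hz]
  refine ⟨F, ρ, hρ, fun z hz => ?_, hinv, hFz, ?_⟩
  · have hz' : ‖z‖ < ρ := by simpa using hz
    refine DifferentiableAt.differentiableWithinAt ?_
    by_cases h1 : z = 1
    · subst h1
      have hreg : IsUnit (regularFactor k a 1) := by rwa [regularFactor_one]
      have hd : DifferentiableAt ℂ (fun z => rightFactor k a z *
          Ring.inverse (regularFactor k a z)) 1 :=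
        differentiable_rightFactor.differentiableAt.mul
          (differentiable_regularFactor.differentiableAt.inverse hreg)
      refine hd.congr_of_eventuallyEq ?_
      have hu : ∀ᶠ z in nhds (1 : ℂ), IsUnit (regularFactor k a z) :=
        differentiable_regularFactor.continuous.continuousAt.eventually
          (Units.isOpen.mem_nhds hreg)
      have hb : ∀ᶠ z in nhds (1 : ℂ), ‖z‖ < ρ :=
        continuous_norm.continuousAt.eventually_lt continuousAt_const hz'
      filter_upwards [hu, hb] with z h2 h3
      by_cases h1 : z = 1
      · rw [h1, hF1, rightFactor_one, regularFactor_one]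
      · have h4 := hinv z h3 h1
        rw [hFz z h1]
        have h5 : arPoly k a z * (rightFactor k a z * Ring.inverse (regularFactor k a z)) =
            (1 - z) ^ 2 • (1 : H →L[ℂ] H) := by
          rw [← mul_assoc, hA.arPoly_mul_rightFactor, smul_mul_assoc,
            Ring.mul_inverse_cancel _ h2]
        have h6 := congrArg (fun T => Ring.inverse (arPoly k a z) * T) h5
        simp only [Ring.inverse_mul_cancel_left _ _ h4, mul_smul_comm, mul_one] at h6
        exact h6.symm
    · have hd : DifferentiableAt ℂ (fun z => (1 - z) ^ 2 • Ring.inverse (arPoly k a z)) z :=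
        DifferentiableAt.smul (c := fun z : ℂ => (1 - z) ^ 2) (by fun_prop)
          ((differentiable_arPoly k a).differentiableAt.inverse (hinv z hz' h1))
      refine hd.congr_of_eventuallyEq ?_
      filter_upwards [isOpen_ne.mem_nhds h1] with y hy using hFz y hy
  · rw [hF1, mul_assoc, Ring.inverse_mul_cancel _ hM, mul_one]

end Pole

/-! ## Inverses with a pole of second order -/

section RegularInverse

variable {H : Type*} [NormedAddCommGroup H] [InnerProductSpace ℂ H] [CompleteSpace H]
variable {k : ℕ} {a : ℕ → H →L[ℂ] H}

/-- `F` is a differentiable extension of `(1 - z)² A(z)⁻¹` to a disc of radius `ρ > 1`. -/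
structure IsRegularInverse (k : ℕ) (a : ℕ → H →L[ℂ] H) (F : ℂ → H →L[ℂ] H) (ρ : ℝ) : Prop where
  one_lt : 1 < ρ
  differentiableOn : DifferentiableOn ℂ F (Metric.ball 0 ρ)
  isUnit : ∀ z : ℂ, ‖z‖ < ρ → z ≠ 1 → IsUnit (arPoly k a z)
  eq : ∀ z : ℂ, ‖z‖ < ρ → z ≠ 1 → F z = (1 - z) ^ 2 • Ring.inverse (arPoly k a z)

/-- The relations between the first coefficients of `A(z)` and those of `(1 - z)² A(z)⁻¹`. -/
structure IsCoeffInverse (k : ℕ) (a : ℕ → H →L[ℂ] H) (C₀ C₁ C₂ : H →L[ℂ] H) : Prop where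
  left_zero : arCoeff k a 0 * C₀ = 0
  left_one : arCoeff k a 0 * C₁ + arCoeff k a 1 * C₀ = 0
  right_zero : C₀ * arCoeff k a 0 = 0
  right_one : C₀ * arCoeff k a 1 + C₁ * arCoeff k a 0 = 0
  right_two : C₀ * arCoeff k a 2 + C₁ * arCoeff k a 1 + C₂ * arCoeff k a 0 = 1

namespace IsRegularInverse

variable {F : ℂ → H →L[ℂ] H} {ρ : ℝ} (h : IsRegularInverse k a F ρ)
include h

omit [CompleteSpace H] in
theorem mul_arPoly {z : ℂ} (hz : ‖z‖ < ρ) (hz1 : z ≠ 1) :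
    F z * arPoly k a z = (1 - z) ^ 2 • (1 : H →L[ℂ] H) := by
  rw [h.eq z hz hz1, smul_mul_assoc, Ring.inverse_mul_cancel _ (h.isUnit z hz hz1)]

omit [CompleteSpace H] in
theorem arPoly_mul {z : ℂ} (hz : ‖z‖ < ρ) (hz1 : z ≠ 1) :
    arPoly k a z * F z = (1 - z) ^ 2 • (1 : H →L[ℂ] H) := by
  rw [h.eq z hz hz1, mul_smul_comm, Ring.mul_inverse_cancel _ (h.isUnit z hz hz1)]

omit [CompleteSpace H] in
theorem eventually_mul_arPoly :
    ∀ᶠ z in nhds (0 : ℂ), F z * arPoly k a z = (1 - z) ^ 2 • (1 : H →L[ℂ] H) := by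
  filter_upwards [Metric.ball_mem_nhds (0 : ℂ) (zero_lt_one.trans h.one_lt),
    isOpen_ne.mem_nhds (zero_ne_one (α := ℂ))] with z hz hz1
  exact h.mul_arPoly (by simpa using hz) hz1

omit [CompleteSpace H] in
theorem ball_mem_nhds_one : Metric.ball (0 : ℂ) ρ ∈ nhds 1 :=
  Metric.isOpen_ball.mem_nhds (by simpa using h.one_lt)

theorem exists_expansion :
    ∃ (C₁ : H →L[ℂ] H) (g : ℂ → H →L[ℂ] H), C₁ = -deriv F 1 ∧
      DifferentiableOn ℂ g (Metric.ball 0 ρ) ∧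
      (∀ z, F z = F 1 + (1 - z) • C₁ + (1 - z) ^ 2 • g z) ∧
      IsCoeffInverse k a (F 1) C₁ (g 1) := by
  obtain ⟨C₁, g, hg, hC, hF⟩ := exists_taylor_two h.one_lt h.differentiableOn
  have hev : ∀ᶠ z in nhdsWithin (1 : ℂ) {1}ᶜ, ‖z‖ < ρ ∧ z ≠ 1 := by
    filter_upwards [nhdsWithin_le_nhds h.ball_mem_nhds_one, self_mem_nhdsWithin] with z h1 h2
    exact ⟨by simpa using h1, h2⟩
  have hgc : ContinuousAt g 1 := (hg.differentiableAt h.ball_mem_nhds_one).continuousAt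
  have hac : ContinuousAt (arTail k a 2) 1 := (differentiable_arTail k a 2).continuous.continuousAt
  obtain ⟨l0, l1, -⟩ := coeff_identities_of_mul_eq hac hgc (by
    filter_upwards [hev] with z hz
    rw [← arPoly_eq, ← hF]
    exact h.arPoly_mul hz.1 hz.2)
  obtain ⟨r0, r1, r2⟩ := coeff_identities_of_mul_eq hgc hac (by
    filter_upwards [hev] with z hz
    rw [← arPoly_eq, ← hF]
    exact h.mul_arPoly hz.1 hz.2)
  rw [arTail_one] at r2
  exact ⟨C₁, g, hC, hg, hF, l0, l1, r0, r1, r2⟩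

end IsRegularInverse

namespace IsCoeffInverse

variable {C₀ C₁ C₂ : H →L[ℂ] H} (h : IsCoeffInverse k a C₀ C₁ C₂)
include h

omit [CompleteSpace H] in
theorem apply_identities (v : H) :
    arCoeff k a 0 (C₀ v) = 0 ∧ arCoeff k a 1 (C₀ v) = -arCoeff k a 0 (C₁ v) ∧
    C₀ (arCoeff k a 0 v) = 0 ∧ C₀ (arCoeff k a 1 v) = -C₁ (arCoeff k a 0 v) ∧
    C₀ (arCoeff k a 2 v) + C₁ (arCoeff k a 1 v) + C₂ (arCoeff k a 0 v) = v := by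
  have e1 := congrArg (fun T : H →L[ℂ] H => T v) h.left_zero
  have e2 := congrArg (fun T : H →L[ℂ] H => T v) h.left_one
  have e3 := congrArg (fun T : H →L[ℂ] H => T v) h.right_zero
  have e4 := congrArg (fun T : H →L[ℂ] H => T v) h.right_one
  have e5 := congrArg (fun T : H →L[ℂ] H => T v) h.right_two
  simp only [mul_apply_eq_comp, add_apply, zero_apply, one_apply_eq_self] at e1 e2 e3 e4 e5
  exact ⟨e1, eq_neg_of_add_eq_zero_right e2, e3, eq_neg_of_add_eq_zero_left e4, e5⟩

/-- A₀C₀ = 0 puts C₀v in Ker A₀, and A₁C₀v = -A₀C₁v lies in ζ₀, which S₁ projects away. -/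
theorem apply_mem (v : H) : C₀ v ∈ (tau0 k a ⊔ tau1 k a)ᗮ := by
  obtain ⟨e1, e2, -⟩ := h.apply_identities v
  refine mem_orthogonal_sup_iff.2 ⟨e1, ?_⟩
  rw [S1_apply_of_mem_ker e1, e2, Submodule.starProjection_apply_eq_zero_iff]
  exact Submodule.le_orthogonal_orthogonal _ (Submodule.neg_mem _ ⟨C₁ v, rfl⟩)

/-- C₀A₀ = 0 handles ζ₀. On Ker A₀ the operators S₁ and A₁ differ by elements of ζ₀, and C₀A₁ =
-C₁A₀ vanishes there, which handles ζ₁; continuity gives the closure. -/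
theorem apply_eq_zero_of_mem (hA : HasUnitRootOfFiniteType k a) {v : H}
    (hv : v ∈ (zeta0 k a ⊔ zeta1 k a)ᗮᗮ) : C₀ v = 0 := by
  have hle : zeta0 k a ⊔ zeta1 k a ≤ C₀.ker := by
    refine sup_le ?_ ?_
    · rintro _ ⟨u, rfl⟩
      exact (h.apply_identities u).2.2.1
    · rintro _ ⟨u, rfl⟩
      change C₀ (S1 k a u) = 0
      obtain ⟨q, hq⟩ : ∃ q, q = u - (tau0 k a).starProjection u := ⟨_, rfl⟩
      have hq0 : arCoeff k a 0 q = 0 := by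
        have h1 : q ∈ (tau0 k a)ᗮ := hq ▸ Submodule.sub_starProjection_mem_orthogonal u
        rwa [tau0_orthogonal] at h1
      have hSq : S1 k a q = S1 k a u := by
        rw [hq, map_sub, S1_apply_of_mem_tau0 (Submodule.starProjection_apply_mem _ u), sub_zero]
      obtain ⟨r, hr⟩ := hA.arCoeff_one_sub_S1_mem hq0
      have hr' : S1 k a q = arCoeff k a 1 q - arCoeff k a 0 r := by
        have h2 : arCoeff k a 0 r = arCoeff k a 1 q - S1 k a q := hr
        rw [h2, sub_sub_cancel]
      rw [← hSq, hr', map_sub, (h.apply_identities r).2.2.1, (h.apply_identities q).2.2.2.1, hq0]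
      simp
  rw [Submodule.orthogonal_orthogonal_eq_closure] at hv
  exact Submodule.topologicalClosure_minimal _ hle C₀.isClosed_ker hv

/-- A pole of order exactly two forces the `POLE(2)` condition. -/
theorem poleTwoCondition (hA : HasUnitRootOfFiniteType k a) (h0 : C₀ ≠ 0) :
    PoleTwoCondition k a := by
  rw [hA.poleTwoCondition_iff]
  constructor
  · intro v hv hS
    rw [S2_apply_of_mem hv, Submodule.starProjection_apply_eq_zero_iff] at hS
    have h1 := h.apply_eq_zero_of_mem hA hS
    obtain ⟨g, hg⟩ : ∃ g, g = generalizedInverse (arCoeff k a 0) (arCoeff k a 1 v) := ⟨_, rfl⟩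
    have eg : arCoeff k a 0 g = arCoeff k a 1 v := by
      rw [hg]
      exact hA.isGeneralizedInverse.apply_of_mem_range (hA.arCoeff_one_mem hv)
    have h2 := (h.apply_identities v).2.2.2.2
    have h3 := (h.apply_identities g).2.2.2.1
    have h4 : arCoeff21 k a v = arCoeff k a 2 v - arCoeff k a 1 g := by
      simp [arCoeff21, hg]
    -- With A₀v = 0 and A₁v = A₀g, the order-two identity reads v = C₀A₂v + C₁A₀g = C₀(A₂v - A₁g) =
    -- C₀A_{2,1}v.
    rw [(mem_orthogonal_sup_iff.1 hv).1, map_zero, add_zero, ← eg, ← neg_eq_iff_eq_neg.2 h3,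
      ← sub_eq_add_neg, ← map_sub, ← h4, h1] at h2
    exact h2.symm
  · intro hbot
    refine h0 ?_
    ext v
    have := h.apply_mem v
    rwa [hbot, Submodule.mem_bot] at this

/-- Modulo Ker A₀, C₁v equals A₀⁺A₀C₁v = -A₀⁺A₁C₀v, so Im C₁ is controlled by Ker A₀ and Im C₀. -/
theorem finiteDimensional_range (hA : HasUnitRootOfFiniteType k a) :
    FiniteDimensional ℂ C₀.range ∧ FiniteDimensional ℂ C₁.range := by
  have hf := hA.finiteDimensional_orthogonal_tau0
  have h0 : FiniteDimensional ℂ C₀.range := by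
    refine Submodule.finiteDimensional_of_le (S₂ := (tau0 k a)ᗮ) ?_
    rintro _ ⟨v, rfl⟩
    exact Submodule.orthogonal_le le_sup_left (h.apply_mem v)
  refine ⟨h0, ?_⟩
  let G := generalizedInverse (arCoeff k a 0)
  refine Submodule.finiteDimensional_of_le (S₂ := (tau0 k a)ᗮ ⊔
    C₀.range.map ((G * arCoeff k a 1 : H →L[ℂ] H) : H →ₗ[ℂ] H)) ?_
  rintro _ ⟨v, rfl⟩
  have h1 : C₁ v - G (arCoeff k a 0 (C₁ v)) ∈ (tau0 k a)ᗮ := by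
    rw [tau0_orthogonal]
    change arCoeff k a 0 (C₁ v - G (arCoeff k a 0 (C₁ v))) = 0
    rw [map_sub, hA.isGeneralizedInverse.apply_of_mem_range (y := arCoeff k a 0 (C₁ v)) ⟨_, rfl⟩,
      sub_self]
  have h2 : G (arCoeff k a 0 (C₁ v)) ∈
      C₀.range.map ((G * arCoeff k a 1 : H →L[ℂ] H) : H →ₗ[ℂ] H) := by
    refine ⟨C₀ (-v), ⟨-v, rfl⟩, ?_⟩
    change G (arCoeff k a 1 (C₀ (-v))) = _
    rw [(h.apply_identities (-v)).2.1]
    simp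
  have h3 := Submodule.add_mem_sup h1 h2
  rwa [sub_add_cancel] at h3

end IsCoeffInverse

/-- The Laurent expansion of the inverse. -/
theorem IsRegularInverse.exists_laurent {F : ℂ → H →L[ℂ] H} {ρ : ℝ}
    (h : IsRegularInverse k a F ρ) :
    ∃ C : ℕ → H →L[ℂ] H, IsLaurentExpansionOfInverse k a 2 C ∧ C 0 = F 1 ∧
      C 1 = -deriv F 1 := by
  obtain ⟨p, hp⟩ := h.differentiableOn.analyticAt h.ball_mem_nhds_one
  have hev := hasFPowerSeriesAt_iff'.1 hp
  -- The signs convert powers of z - 1 into powers of 1 - z.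
  refine ⟨fun n => (-1 : ℂ) ^ n • p.coeff n, ?_, ?_, ?_⟩
  · obtain ⟨δ, hδ, hδ'⟩ := Metric.eventually_nhds_iff_ball.1 (hev.and h.ball_mem_nhds_one)
    refine ⟨δ, hδ, fun z hz hz1 => ?_⟩
    obtain ⟨h1, h2⟩ := hδ' z (by rwa [Metric.mem_ball, dist_eq_norm])
    have hw : (1 - z) ≠ 0 := sub_ne_zero.2 (Ne.symm hz1)
    have h3 := h1.const_smul ((1 - z) ^ 2)⁻¹
    rw [h.eq z (by simpa using h2) hz1, inv_smul_smul₀ (pow_ne_zero 2 hw)] at h3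
    refine (congrArg (fun f => HasSum f (Ring.inverse (arPoly k a z)))
      (funext fun n => ?_)).mpr h3
    rw [smul_smul, smul_smul, zpow_sub₀ hw, zpow_natCast, mul_comm, div_eq_mul_inv]
    congr 1
    have h4 : (z - 1) ^ n = (-1) ^ n * (1 - z) ^ n := by
      rw [← mul_pow]; congr 1; ring
    rw [h4, show ((2 : ℕ) : ℤ) = 2 from rfl, zpow_ofNat]
    ring
  · simpa using! hp.coeff_zero 1
  · have h1 : p.coeff 1 = deriv F 1 := hp.deriv.symm
    simp [h1]

end RegularInverse

/-! ## Integration of the autoregressive process -/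

section Differences

theorem diffOp_iterate_apply {Ω M : Type*} [AddCommGroup M] (m : ℕ) (u : ℤ → Ω → M) (t : ℤ)
    (ω : Ω) : diffOp^[m] u t ω = diffOp^[m] (fun s => u s ω) t := by
  induction m generalizing t with
  | zero => rfl
  | succ m ih =>
    simp only [Function.iterate_succ_apply']
    change diffOp^[m] u t ω - diffOp^[m] u (t - 1) ω = _
    rw [ih, ih]
    rfl

theorem diffOp_iterate_map {M N : Type*} [AddCommGroup M] [AddCommGroup N] (f : M →+ N)
    (m : ℕ) (u : ℤ → M) (t : ℤ) : diffOp^[m] (fun s => f (u s)) t = f (diffOp^[m] u t) := by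
  induction m generalizing t with
  | zero => rfl
  | succ m ih => simp only [Function.iterate_succ_apply', diffOp, ih, map_sub]

theorem diffOp_iterate_sub {M : Type*} [AddCommGroup M] (m : ℕ) (u e : ℤ → M) (t : ℤ) :
    diffOp^[m] (fun s => u s - e s) t = diffOp^[m] u t - diffOp^[m] e t := by
  induction m generalizing t with
  | zero => rfl
  | succ m ih =>
    simp only [Function.iterate_succ_apply', diffOp, ih]
    abel

theorem diffOp_cumul {M : Type*} [AddCommGroup M] (w : ℤ → M) : diffOp (cumul w) = w := by
  funext t
  simp only [diffOp, cumul]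
  rcases le_or_gt 1 t with ht | ht
  · rw [Finset.Icc_eq_empty (a := t + 1) (b := 0) (by omega),
      Finset.Icc_eq_empty (a := t - 1 + 1) (b := 0) (by omega)]
    have h : Finset.Icc 1 t = insert t (Finset.Icc 1 (t - 1)) := by
      ext i; simp only [Finset.mem_Icc, Finset.mem_insert]; omega
    rw [h, Finset.sum_insert (by simp)]
    simp
  · rw [Finset.Icc_eq_empty (a := 1) (b := t) (by omega),
      Finset.Icc_eq_empty (a := 1) (b := t - 1) (by omega)]
    have h : Finset.Icc (t - 1 + 1) 0 = insert t (Finset.Icc (t + 1) 0) := by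
      ext i; simp only [Finset.mem_Icc, Finset.mem_insert]; omega
    rw [h, Finset.sum_insert (by simp)]
    simp

theorem cumul_zero {M : Type*} [AddCommGroup M] (w : ℤ → M) : cumul w 0 = 0 := by
  simp [cumul]

/-- The first difference is constant; induction in both directions over the integers does the rest.
It produces the initial-value term of the common trends representation. -/
theorem eq_add_smul_of_diffOp_eq_zero {M : Type*} [AddCommGroup M] {d : ℤ → M}
    (h : ∀ t, diffOp^[2] d t = 0) (t : ℤ) : d t = d 0 + t • diffOp d 0 := by
  have h1 : ∀ t, diffOp d t = diffOp d (t - 1) := fun t => sub_eq_zero.1 (h t)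
  have h2 : ∀ t, diffOp d t = diffOp d 0 := fun t => by
    induction t with
    | zero => rfl
    | succ i ih => rw [h1, add_sub_cancel_right, ih]
    | pred i ih => rw [← h1, ih]
  have h3 : ∀ t, d t = d (t - 1) + diffOp d 0 := fun t => by
    rw [← h2 t]; simp [diffOp]
  induction t with
  | zero => simp
  | succ i ih => rw [h3, add_sub_cancel_right, ih, add_smul, one_smul, add_assoc]
  | pred i ih =>
    have h4 := h3 (-(i : ℤ))
    rw [ih] at h4
    rw [eq_sub_of_add_eq h4.symm, sub_smul, one_smul]
    abel

end Differences

/-! ### Order of integration two and the double pole. -/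

section Integration

variable {H : Type*} [NormedAddCommGroup H] [InnerProductSpace ℂ H] [CompleteSpace H]
variable {K : Type*} [NormedAddCommGroup K] [NormedSpace ℂ K]
variable {Ω : Type*} [MeasurableSpace Ω] {P : Measure Ω}
variable {k : ℕ} {a : ℕ → H →L[ℂ] H} {ε x : ℤ → Ω → H}
variable {F : ℂ → H →L[ℂ] H} {ρ : ℝ}

omit [CompleteSpace H] in
theorem IsAbsolutelyConvergent.isDiscSeries [CompleteSpace K] {B : ℕ → H →L[ℂ] K}
    (h : IsAbsolutelyConvergent B) : IsDiscSeries B (fun z => ∑' n, z ^ n • B n) := by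
  obtain ⟨ρ, hρ, H⟩ := h
  refine ⟨ρ, hρ, fun z hz => ⟨H z hz, (Summable.of_norm ?_).hasSum⟩⟩
  refine (H z hz).congr fun n => ?_
  rw [norm_smul, norm_pow, mul_comm]

omit [CompleteSpace H] in
theorem IsDiscSeries.isAbsolutelyConvergent {B : ℕ → H →L[ℂ] K} {G : ℂ → H →L[ℂ] K}
    (h : IsDiscSeries B G) : IsAbsolutelyConvergent B := by
  obtain ⟨ρ, hρ, H⟩ := h
  exact ⟨ρ, hρ, fun z hz => (H z hz).1⟩

theorem IsFilterOf.isLinearFilterOf [CompleteSpace K] [IsProbabilityMeasure P] {B : ℕ → H →L[ℂ] K}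
    {G : ℂ → H →L[ℂ] K} {u : ℤ → Ω → K} (hu : IsFilterOf P ε B u) (hB : IsDiscSeries B G)
    (hgr : HasPolynomialGrowth P ε) (h0 : ∀ t, ∫ ω, ε t ω ∂P = 0) :
    IsLinearFilterOf P ε B u := by
  refine ⟨hB.isAbsolutelyConvergent, hgr.integrable_of_hasSymbol ⟨B, hB, hu⟩, fun t => ?_⟩
  filter_upwards [hu t] with ω hω
  rwa [hgr.integral_eq_zero_of_hasSymbol ⟨B, hB, hu⟩ h0, sub_zero]

theorem HasSymbol.isScalarIntegratedOfOrder [IsProbabilityMeasure P] {φ : ℂ → H →L[ℂ] ℂ} {d : ℕ}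
    {w : ℤ → Ω → ℂ} (hw : HasSymbol P ε φ (diffOp^[d] w)) (h1 : φ 1 ≠ 0)
    (hgr : HasPolynomialGrowth P ε) (h0 : ∀ t, ∫ ω, ε t ω ∂P = 0) :
    IsScalarIntegratedOfOrder P ε d w := by
  obtain ⟨B, hB, hBu⟩ := hw
  exact ⟨B, hBu.isLinearFilterOf hB hgr h0, by rwa [hB.one.1.tsum_eq]⟩

omit [CompleteSpace H] in
/-- If `u = G(L) x` and `φ(z) A(z) = G(z)` with `φ` differentiable on a disc of radius larger
than `1`, then `u = φ(L) ε`. -/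
theorem IsARSolution.hasSymbol_of_comp_eq [CompleteSpace K] [IsProbabilityMeasure P]
    (hx : IsARSolution P k a ε x)
    (hρ : 1 < ρ) {φ G : ℂ → H →L[ℂ] K} {u : ℤ → Ω → K}
    (hφ : DifferentiableOn ℂ φ (Metric.ball 0 ρ)) (hu : HasSymbol P x G u)
    (hG : ∀ᶠ z in nhds (0 : ℂ), (φ z).comp (arPoly k a z) = G z) : HasSymbol P ε φ u := by
  obtain ⟨B, hB⟩ := exists_isDiscSeries hρ hφ
  exact ⟨B, hB, hx.isFilterOf_noise hB hu hG⟩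

theorem IsRegularInverse.hasSymbol [IsProbabilityMeasure P] (h : IsRegularInverse k a F ρ)
    (hx : IsARSolution P k a ε x) : HasSymbol P ε F (diffOp^[2] x) :=
  hx.hasSymbol_of_comp_eq h.one_lt h.differentiableOn (hasSymbol_self.diff_iterate 2)
    h.eventually_mul_arPoly

omit [CompleteSpace H] in
theorem IsRegularInverse.apply_zero (h : IsRegularInverse k a F ρ) : F 0 = 1 := by
  have h1 : arPoly k a 0 = 1 := by
    rw [arPoly, Finset.sum_eq_zero, sub_zero]
    intro i hi
    rw [zero_pow (by have := (Finset.mem_Icc.1 hi).1; omega), zero_smul]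
  rw [h.eq 0 (by simpa using zero_lt_one.trans h.one_lt) zero_ne_one, h1]
  simp

theorem IsRegularInverse.isIntegratedOfOrder_two [IsProbabilityMeasure P]
    (h : IsRegularInverse k a F ρ) (h1 : F 1 ≠ 0) (hε : IsWhiteNoise P ε)
    (hx : IsARSolution P k a ε x) : IsIntegratedOfOrder P ε 2 x := by
  obtain ⟨B, hB, hBu⟩ := h.hasSymbol hx
  refine ⟨B, ?_, hBu.isLinearFilterOf hB hx.hasPolynomialGrowth_noise hε.mean_zero,
    by rwa [hB.one.1.tsum_eq]⟩
  -- The normalization B₀ = I is F(0) = A(0)⁻¹ = I.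
  rw [← h.apply_zero]
  obtain ⟨r, hr, H⟩ := hB
  have h2 := (H 0 (by simpa using zero_lt_one.trans hr)).2
  have h3 := hasSum_single (f := fun n : ℕ => (0 : ℂ) ^ n • B n) 0 (fun n hn => by simp [hn])
  simpa using h3.unique h2

/-- If `x` is `I(2)` and the noise is nondegenerate, then `A(z)⁻¹` has a pole of order two. -/
theorem IsIntegratedOfOrder.exists_isRegularInverse [IsProbabilityMeasure P]
    (hI : IsIntegratedOfOrder P ε 2 x) (hA : HasUnitRootOfFiniteType k a)
    (hn : IsNondegenerate P ε) (hε : IsWhiteNoise P ε) (hx : IsARSolution P k a ε x) :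
    ∃ (F : ℂ → H →L[ℂ] H) (ρ : ℝ), IsRegularInverse k a F ρ ∧ F 1 ≠ 0 := by
  obtain ⟨B, -, hB, hB1⟩ := hI
  have hBF := hB.absConv.isDiscSeries
  set F : ℂ → H →L[ℂ] H := fun z => ∑' n, z ^ n • B n with hF
  set μ : ℤ → H := fun t => ∫ ω', diffOp^[2] x t ω' ∂P with hμ
  have s1 : HasSymbol P ε F (fun t ω => diffOp^[2] x t ω - μ t) := ⟨B, hBF, hB.hasSum⟩
  have s2 := s1.arPoly_comp k a
  have s3 : HasSymbol P ε (fun z => (1 - z) ^ 2 • (1 : H →L[ℂ] H)) (diffOp^[2] ε) :=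
    hasSymbol_self.diff_iterate 2
  -- A(L)Δ²x = Δ²ε by the AR equation, so the filters with symbols A(z)F(z) and (1-z)² differ at
  -- time 0 only by a deterministic combination of means.
  have e1 : ∀ᵐ ω ∂P, diffOp^[2] x 0 ω -
      ∑ h ∈ Finset.Icc 1 k, a h (diffOp^[2] x (0 - (h : ℤ)) ω) = diffOp^[2] ε 0 ω := by
    refine ((hasSymbol_self.diff_iterate 2).arPoly_comp k a).ae_eq
      (hx.hasSymbol_noise.diff_iterate 2) (Filter.Eventually.of_forall fun z => ?_) 0
    ext v
    simp
  obtain ⟨r, hr, hr0⟩ := hn.symbol_eq_zero hε hx.hasPolynomialGrowth_noise (s2.sub s3) (t := 0)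
    (c := -(μ 0 - ∑ h ∈ Finset.Icc 1 k, a h (μ (0 - (h : ℤ))))) (by
      filter_upwards [e1] with ω hω
      rw [← hω]
      simp only [map_sub, Finset.sum_sub_distrib]
      abel)
  obtain ⟨r', hr', hd⟩ := hBF.differentiableOn
  obtain ⟨r'', hr'', hinv⟩ := hA.invertible
  refine ⟨F, min r (min r' r''), ⟨lt_min hr (lt_min hr' hr''), hd.mono
    (Metric.ball_subset_ball ((min_le_right _ _).trans (min_le_left _ _))), ?_, ?_⟩, ?_⟩
  · intro z hz hz1
    exact hinv z (hz.trans_le ((min_le_right _ _).trans (min_le_right _ _))) hz1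
  · intro z hz hz1
    have hu := hinv z (hz.trans_le ((min_le_right _ _).trans (min_le_right _ _))) hz1
    have h1 : arPoly k a z * F z = (1 - z) ^ 2 • (1 : H →L[ℂ] H) :=
      sub_eq_zero.1 (hr0 z (hz.trans_le (min_le_left _ _)))
    have h2 := congrArg (fun T => Ring.inverse (arPoly k a z) * T) h1
    simpa only [Ring.inverse_mul_cancel_left _ _ hu, mul_smul_comm, mul_one] using h2
  · simpa [hF] using hB1

end Integration

/-! ## The common trends representation -/

section CommonTrends

variable {H : Type*} [NormedAddCommGroup H] [InnerProductSpace ℂ H] [CompleteSpace H]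
variable {Ω : Type*} [MeasurableSpace Ω] {P : Measure Ω} [IsProbabilityMeasure P]
variable {k : ℕ} {a : ℕ → H →L[ℂ] H} {ε x : ℤ → Ω → H}
variable {F : ℂ → H →L[ℂ] H} {ρ : ℝ}

omit [InnerProductSpace ℂ H] [CompleteSpace H] [IsProbabilityMeasure P] in
theorem integrable_cumul {w : ℤ → Ω → H} (h : ∀ t, Integrable (w t) P) (t : ℤ) :
    Integrable (cumul w t) P :=
  (integrable_finsetSum' _ fun i _ => h i).sub (integrable_finsetSum' _ fun i _ => h i)

omit [CompleteSpace H] [IsProbabilityMeasure P] in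
theorem integral_cumul {w : ℤ → Ω → H} (h : ∀ t, Integrable (w t) P)
    (h0 : ∀ t, ∫ ω, w t ω ∂P = 0) (t : ℤ) : ∫ ω, cumul w t ω ∂P = 0 := by
  have h1 : ∀ ω, cumul w t ω =
      (∑ i ∈ Finset.Icc 1 t, w i ω) - ∑ i ∈ Finset.Icc (t + 1) 0, w i ω := fun ω => by
    simp [cumul]
  simp only [h1]
  rw [integral_sub (integrable_finsetSum _ fun i _ => h i)
    (integrable_finsetSum _ fun i _ => h i), integral_finsetSum _ fun i _ => h i,
    integral_finsetSum _ fun i _ => h i]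
  simp [h0]

omit [CompleteSpace H] [MeasurableSpace Ω] in
theorem diffOp_two_sub_trends (C₀ C₁ : H →L[ℂ] H) (ε x y : ℤ → Ω → H) (t : ℤ) (ω : Ω) :
    diffOp^[2] (fun s => x s ω - C₀ (cumul (cumul ε) s ω) - C₁ (cumul ε s ω) - y s ω) t =
      diffOp^[2] x t ω - C₀ (ε t ω) - C₁ (diffOp ε t ω) - diffOp^[2] y t ω := by
  have e1 : ∀ s, cumul ε s ω = cumul ε (s - 1) ω + ε s ω := fun s => by
    have h := congrFun (congrFun (diffOp_cumul ε) s) ω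
    rw [← h]
    simp [diffOp]
  have e2 : ∀ s, cumul (cumul ε) s ω = cumul (cumul ε) (s - 1) ω + cumul ε s ω := fun s => by
    have h := congrFun (congrFun (diffOp_cumul (cumul ε)) s) ω
    rw [← h]
    simp [diffOp]
  simp only [Function.iterate_succ_apply', Function.iterate_zero, id_eq, diffOp, Pi.sub_apply]
  rw [e2 t, e2 (t - 1), e1 t, e1 (t - 1)]
  simp only [map_add, map_sub]
  abel

/-- Let g be the quadratic Taylor remainder of F at 1 and y = g(L)ε. Removing the trends and y from
x leaves a process whose second difference has symbol F(z) - C₀ - (1-z)C₁ - (1-z)²g(z) = 0. -/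
theorem IsRegularInverse.exists_commonTrends (h : IsRegularInverse k a F ρ)
    (hA : HasUnitRootOfFiniteType k a) (hε : IsWhiteNoise P ε) (hx : IsARSolution P k a ε x)
    {C : ℕ → H →L[ℂ] H} (hC0 : C 0 = F 1) (hC1 : C 1 = -deriv F 1) :
    ∃ (Cstar : ℕ → H →L[ℂ] H) (y : ℤ → Ω → H) (v₀ v₁ : Ω → H),
      IsCommonTrendsRepresentationTwo P k a ε x C Cstar y v₀ v₁ := by
  obtain ⟨C₁, g, hC₁, hg, hF, hcoef⟩ := h.exists_expansion
  obtain rfl : C₁ = C 1 := hC₁.trans hC1.symm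
  rw [← hC0] at hF hcoef
  obtain ⟨Cstar, hCs⟩ := exists_isDiscSeries h.one_lt hg
  have hgr := hx.hasPolynomialGrowth_noise
  set y : ℤ → Ω → H := fun t ω => ∑' n : ℕ, Cstar n (ε (t - (n : ℤ)) ω) with hy
  have hyf : IsFilterOf P ε Cstar y := hgr.isFilterOf_tsum hCs
  have hyl := hyf.isLinearFilterOf hCs hgr hε.mean_zero
  have hy0 := hgr.integral_eq_zero_of_hasSymbol ⟨Cstar, hCs, hyf⟩ hε.mean_zero
  have hyi := hyl.integrable
  have hxi := hx.hasPolynomialGrowth.integrable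
  have hεi := hgr.integrable
  have hrep : ∀ t : ℤ, ∀ᵐ ω ∂P, x t ω = C 0 (cumul (cumul ε) t ω) + C 1 (cumul ε t ω) + y t ω +
      ((x 0 ω - y 0 ω) + (t : ℂ) • (diffOp x 0 ω - diffOp y 0 ω - C 1 (ε 0 ω))) := by
    intro t
    have s1 := (((h.hasSymbol hx).sub (hasSymbol_self.clm_comp (C 0))).sub
      (hasSymbol_self.diff.clm_comp (C 1))).sub
      (HasSymbol.diff_iterate ⟨Cstar, hCs, hyf⟩ 2)
    have s2 := fun s => s1.ae_eq hasSymbol_zero (Filter.Eventually.of_forall fun z => by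
      rw [hF z]
      ext v
      simp only [ContinuousLinearMap.comp_apply, sub_apply, add_apply, smul_apply, zero_apply,
        one_apply_eq_self, map_smul]
      abel) s
    -- All times are collected into one null set, since the recursion is solved along a fixed path.
    filter_upwards [ae_all_iff.2 s2] with ω hω
    set d : ℤ → H := fun s =>
      x s ω - C 0 (cumul (cumul ε) s ω) - C 1 (cumul ε s ω) - y s ω with hd
    have h1 : ∀ s, diffOp^[2] d s = 0 := fun s => by
      rw [hd, diffOp_two_sub_trends]
      exact hω s
    have h2 := eq_add_smul_of_diffOp_eq_zero h1 t
    have h3 : d 0 = x 0 ω - y 0 ω := by simp [hd, cumul_zero]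
    have h4 : diffOp d 0 = diffOp x 0 ω - diffOp y 0 ω - C 1 (ε 0 ω) := by
      have e1 := congrFun (congrFun (diffOp_cumul ε) 0) ω
      have e2 := congrFun (congrFun (diffOp_cumul (cumul ε)) 0) ω
      -- At time -1 the single cumulation equals -ε₀ and the double one 0; hence C₁ε₀ is subtracted
      -- in v₁ and no C₀ term occurs.
      simp only [diffOp, Pi.sub_apply, cumul_zero, Pi.zero_apply, zero_sub, neg_eq_zero] at e1 e2
      rw [← e1]
      simp only [hd, diffOp, Pi.sub_apply, cumul_zero, Pi.zero_apply, zero_sub, e2, map_zero,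
        map_neg]
      abel
    rw [h3, h4, ← Int.cast_smul_eq_zsmul ℂ, hd] at h2
    beta_reduce at h2
    rw [← h2]
    abel
  refine ⟨Cstar, y, fun ω => x 0 ω - y 0 ω, fun ω => diffOp x 0 ω - diffOp y 0 ω - C 1 (ε 0 ω),
    ?_, ?_, hyl, hy0, Filter.Eventually.of_forall fun _ => rfl,
    Filter.Eventually.of_forall fun _ => rfl, hrep, ?_⟩
  · intro n hn
    have hfr := hcoef.finiteDimensional_range hA
    interval_cases n
    exacts [hfr.1, hfr.2]
  · obtain ⟨r, hr, hser⟩ := hCs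
    refine ⟨min r ρ, lt_min hr h.one_lt, fun z hz hz1 => ?_⟩
    have h1 := (hser z (hz.trans_le (min_le_left _ _))).2
    have hw : (1 - z) ≠ 0 := sub_ne_zero.2 (Ne.symm hz1)
    have h2 : Ring.inverse (arPoly k a z) = ((1 - z) ^ 2)⁻¹ • F z := by
      rw [h.eq z (hz.trans_le (min_le_right _ _)) hz1, inv_smul_smul₀ (pow_ne_zero 2 hw)]
    have h3 : Ring.inverse (arPoly k a z) - ((1 - z) ^ 2)⁻¹ • C 0 - (1 - z)⁻¹ • C 1 = g z := by
      rw [h2, hF z, smul_add, smul_add, inv_smul_smul₀ (pow_ne_zero 2 hw), smul_smul]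
      have h4 : ((1 - z) ^ 2)⁻¹ * (1 - z) = (1 - z)⁻¹ := by field_simp
      rw [h4]
      abel
    rwa [h3]
  · intro t
    have i0 : Integrable (fun ω => x 0 ω - y 0 ω) P := (hxi 0).sub (hyi 0)
    have i1 : Integrable (fun ω => diffOp x 0 ω - diffOp y 0 ω - C 1 (ε 0 ω)) P :=
      (((hxi 0).sub (hxi _)).sub ((hyi 0).sub (hyi _))).sub ((C 1).integrable_comp (hεi 0))
    have j1 := integrable_cumul hεi
    have j2 := integrable_cumul j1
    have m1 := integral_cumul hεi hε.mean_zero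
    have m2 := integral_cumul j1 m1
    have k2 := (C 0).integrable_comp (j2 t)
    have k1 := (C 1).integrable_comp (j1 t)
    have k3 : Integrable
        (fun ω => C 0 (cumul (cumul ε) t ω) + C 1 (cumul ε t ω)) P := k2.add k1
    have k4 : Integrable
        (fun ω => C 0 (cumul (cumul ε) t ω) + C 1 (cumul ε t ω) + y t ω) P := k3.add (hyi t)
    have i2 : Integrable
        (fun ω => (t : ℂ) • (diffOp x 0 ω - diffOp y 0 ω - C 1 (ε 0 ω))) P := i1.smul _
    have i3 : Integrable (fun ω => x 0 ω - y 0 ω +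
        (t : ℂ) • (diffOp x 0 ω - diffOp y 0 ω - C 1 (ε 0 ω))) P := i0.add i2
    rw [integral_congr_ae (hrep t), integral_add k4 i3, integral_add k3 (hyi t),
      integral_add k2 k1, (C 0).integral_comp_comm (j2 t),
      (C 1).integral_comp_comm (j1 t), m2, m1, hy0, integral_add i0 i2, integral_smul]
    simp

end CommonTrends

/-! ## Cointegration -/

section Cointegration

variable {H : Type*} [NormedAddCommGroup H] [InnerProductSpace ℂ H] [CompleteSpace H]
variable {Ω : Type*} [MeasurableSpace Ω] {P : Measure Ω}
variable {k : ℕ} {a : ℕ → H →L[ℂ] H} {ε x : ℤ → Ω → H}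
variable {F : ℂ → H →L[ℂ] H} {ρ : ℝ}

/-- `φ(z) A(z) = ψ(z)` near `0`, where `φ` is differentiable on the disc of radius `ρ`. -/
structure IsTransfer (k : ℕ) (a : ℕ → H →L[ℂ] H) (ρ : ℝ) (ψ φ : ℂ → H →L[ℂ] ℂ) : Prop where
  differentiableOn : DifferentiableOn ℂ φ (Metric.ball 0 ρ)
  comp_eq : ∀ᶠ z in nhds (0 : ℂ), (φ z).comp (arPoly k a z) = ψ z

namespace IsTransfer

variable {ψ φ ψ' φ' : ℂ → H →L[ℂ] ℂ}

omit [CompleteSpace H] in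
theorem add (h : IsTransfer k a ρ ψ φ) (h' : IsTransfer k a ρ ψ' φ') :
    IsTransfer k a ρ (fun z => ψ z + ψ' z) (fun z => φ z + φ' z) := by
  refine ⟨h.differentiableOn.add h'.differentiableOn, ?_⟩
  filter_upwards [h.comp_eq, h'.comp_eq] with z h1 h2
  rw [ContinuousLinearMap.add_comp, h1, h2]

omit [CompleteSpace H] in
theorem sub (h : IsTransfer k a ρ ψ φ) (h' : IsTransfer k a ρ ψ' φ') :
    IsTransfer k a ρ (fun z => ψ z - ψ' z) (fun z => φ z - φ' z) := by
  refine ⟨h.differentiableOn.sub h'.differentiableOn, ?_⟩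
  filter_upwards [h.comp_eq, h'.comp_eq] with z h1 h2
  rw [ContinuousLinearMap.sub_comp, h1, h2]

omit [CompleteSpace H] in
theorem smul (h : IsTransfer k a ρ ψ φ) :
    IsTransfer k a ρ (fun z => (1 - z) • ψ z) (fun z => (1 - z) • φ z) := by
  refine ⟨DifferentiableOn.smul (c := fun z : ℂ => 1 - z) (by fun_prop) h.differentiableOn, ?_⟩
  filter_upwards [h.comp_eq] with z h1
  rw [ContinuousLinearMap.smul_comp, h1]

omit [CompleteSpace H] in
theorem congr (h : IsTransfer k a ρ ψ φ) (hψ : ∀ z, ψ z = ψ' z) : IsTransfer k a ρ ψ' φ := by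
  obtain rfl : ψ = ψ' := funext hψ
  exact h

omit [CompleteSpace H] in
theorem hasSymbol [IsProbabilityMeasure P] (h : IsTransfer k a ρ ψ φ) (hρ : 1 < ρ)
    (hx : IsARSolution P k a ε x) {u : ℤ → Ω → ℂ} (hu : HasSymbol P x ψ u) :
    HasSymbol P ε φ u :=
  hx.hasSymbol_of_comp_eq hρ h.differentiableOn hu h.comp_eq

end IsTransfer

/-- `(1 - z)² f = φ(z) A(z)` for every bounded linear functional `f`. -/
theorem IsRegularInverse.isTransfer (h : IsRegularInverse k a F ρ) (f : H →L[ℂ] ℂ) :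
    IsTransfer k a ρ (fun z => (1 - z) ^ 2 • f) (fun z => f.comp (F z)) := by
  refine ⟨((ContinuousLinearMap.compL ℂ H H ℂ f).differentiable.comp_differentiableOn
    h.differentiableOn), ?_⟩
  filter_upwards [h.eventually_mul_arPoly] with z hz
  ext y
  have h1 := congrArg (fun T : H →L[ℂ] H => T y) hz
  simp only [mul_apply_eq_comp, smul_apply, one_apply_eq_self] at h1
  simp [h1]

/-- The functionals `(1 - z)² f T_j(z)` are divisible by `A(z)`, where `T_j` is a tail of `A`. -/
theorem IsRegularInverse.isTransfer_tail (h : IsRegularInverse k a F ρ) (f : H →L[ℂ] ℂ) (j : ℕ) :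
    IsTransfer k a ρ (fun z => (1 - z) ^ 2 • f.comp (arTail k a j z))
      (fun z => f.comp (arTail k a j z * F z)) := by
  refine ⟨((ContinuousLinearMap.compL ℂ H H ℂ f).differentiable.comp_differentiableOn
    ((differentiable_arTail k a j).differentiableOn.mul h.differentiableOn)), ?_⟩
  filter_upwards [h.eventually_mul_arPoly] with z hz
  ext y
  have h1 := congrArg (fun T : H →L[ℂ] H => T y) hz
  simp only [mul_apply_eq_comp, smul_apply, one_apply_eq_self] at h1
  simp [h1]

omit [CompleteSpace H] in
theorem isTransfer_arPoly (f : H →L[ℂ] ℂ) (ρ : ℝ) :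
    IsTransfer k a ρ (fun z => f.comp (arPoly k a z)) (fun _ => f) :=
  ⟨differentiableOn_const _, Filter.Eventually.of_forall fun _ => rfl⟩

/-- The functional `v ↦ ⟨v, A₀⁺ A₁ ·⟩`. -/
noncomputable def gainFunctional (k : ℕ) (a : ℕ → H →L[ℂ] H) (v : H) : H →L[ℂ] ℂ :=
  (innerSL ℂ v).comp (generalizedInverse (arCoeff k a 0) * arCoeff k a 1)

namespace IsRegularInverse

variable (h : IsRegularInverse k a F ρ) (hA : HasUnitRootOfFiniteType k a)
  (hpiv : F 1 * pivot k a = proj2 k a)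

include hpiv in
theorem apply_pivot_of_mem_tau0 {v : H} (hv : v ∈ tau0 k a) : F 1 (pivot k a v) = 0 := by
  have h1 := congrArg (fun T : H →L[ℂ] H => T v) hpiv
  simp only [mul_apply_eq_comp] at h1
  rw [h1, proj2_of_mem_tau0 hv]

include hpiv in
theorem apply_pivot_of_mem_tau1 {v : H} (hv : v ∈ tau1 k a) : F 1 (pivot k a v) = 0 := by
  have h1 := congrArg (fun T : H →L[ℂ] H => T v) hpiv
  simp only [mul_apply_eq_comp] at h1
  rw [h1, proj2_of_mem_tau1 hv]

include h hA hpiv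

/-- For `v ∈ τ₀` the functional `⟨v, ·⟩ + (1 - z) ⟨v, A₀⁺ A₁ ·⟩` is divisible by `A(z)`. -/
theorem exists_isTransfer_tau0 {v : H} (hv : v ∈ tau0 k a) :
    ∃ φ : ℂ → H →L[ℂ] ℂ,
      IsTransfer k a ρ (fun z => innerSL ℂ v + (1 - z) • gainFunctional k a v) φ ∧
      φ 1 (pivot k a v) = inner ℂ v v := by
  set G := generalizedInverse (arCoeff k a 0) with hG
  set f : H →L[ℂ] ℂ := (innerSL ℂ v).comp G with hf
  -- Expand f∘A(z) with f = ⟨v, A₀⁺·⟩: since fA₀ = ⟨v,·⟩ on τ₀-vectors v, the first two terms are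
  -- the desired functional, and the quadratic tail is itself divisible by A(z).
  refine ⟨_, ((isTransfer_arPoly f ρ).sub (h.isTransfer_tail f 2)).congr fun z => ?_, ?_⟩
  · ext y
    have h1 : inner ℂ v (G (arCoeff k a 0 y)) = inner ℂ v y :=
      hA.isGeneralizedInverse.inner_apply_apply hv y
    simp [arPoly_eq, hf, gainFunctional, ← hG, h1]
  · have h1 : inner ℂ v (G (arCoeff k a 0 v)) = inner ℂ v v :=
      hA.isGeneralizedInverse.inner_apply_apply hv v
    have h2 := apply_pivot_of_mem_tau0 hpiv hv
    rw [pivot_of_mem_tau0 hv] at h2 ⊢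
    simp [hf, h1, h2]

/-- For `v ∈ τ₀` the functional `(1 - z) ⟨v, ·⟩` is divisible by `A(z)`, with value
`-⟨v, A₀⁺ A₁ C₀ ·⟩` at `z = 1`. -/
theorem exists_isTransfer_diff_tau0 {v : H} (hv : v ∈ tau0 k a) :
    ∃ φ : ℂ → H →L[ℂ] ℂ, IsTransfer k a ρ (fun z => (1 - z) • innerSL ℂ v) φ ∧
      φ 1 = -(gainFunctional k a v).comp (F 1) := by
  obtain ⟨φ, hφ, -⟩ := h.exists_isTransfer_tau0 hA hpiv hv
  -- Multiplying by 1 - z leaves an excess (1-z)² times the gain functional, which F(z) divides.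
  refine ⟨_, (hφ.smul.sub (h.isTransfer (gainFunctional k a v))).congr fun z => ?_, ?_⟩
  · module
  · ext y
    simp

/-- For `v ∈ τ₁` the functional `(1 - z) ⟨v, ·⟩` is divisible by `A(z)`. -/
theorem exists_isTransfer_tau1 {v : H} (hv : v ∈ tau1 k a) :
    ∃ φ : ℂ → H →L[ℂ] ℂ, IsTransfer k a ρ (fun z => (1 - z) • innerSL ℂ v) φ ∧
      φ 1 (pivot k a v) = inner ℂ v v ∧ ∀ u ∈ tau0 k a, φ 1 (pivot k a u) = 0 := by
  obtain ⟨w, hw⟩ := hA.exists_mem_tau1_eq hv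
  set G := generalizedInverse (arCoeff k a 0) with hG
  -- With v = S₁*w, the functional p annihilates Im A₀ and pA₁ = ⟨v,·⟩ on Ker A₀; q corrects the
  -- discrepancy on τ₀.
  set p : H →L[ℂ] ℂ := (innerSL ℂ w).comp (zeta0 k a)ᗮ.starProjection with hp
  set q : H →L[ℂ] ℂ := p.comp (arCoeff k a 1 * G) with hq
  have hp0 : ∀ y, p (arCoeff k a 0 y) = 0 := fun y => by
    have h1 : (zeta0 k a)ᗮ.starProjection (arCoeff k a 0 y) = 0 := by
      rw [Submodule.starProjection_apply_eq_zero_iff]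
      exact Submodule.le_orthogonal_orthogonal _ ⟨y, rfl⟩
    simp [hp, h1]
  have hvy : ∀ y, inner ℂ v y = inner ℂ w (S1 k a y) := fun y => by
    rw [hw, ContinuousLinearMap.adjoint_inner_left]
  have hpS : ∀ y, arCoeff k a 0 y = 0 → p (arCoeff k a 1 y) = inner ℂ v y := fun y hy => by
    rw [hvy, S1_apply_of_mem_ker hy]
    simp [hp]
  have hvp : ∀ y, inner ℂ v y = p (arCoeff k a 1 y) - q (arCoeff k a 0 y) := fun y => by
    have h1 : arCoeff k a 0 (y - G (arCoeff k a 0 y)) = 0 := by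
      rw [map_sub, hA.isGeneralizedInverse.apply_of_mem_range (y := arCoeff k a 0 y) ⟨_, rfl⟩,
        sub_self]
    have h2 : inner ℂ v (G (arCoeff k a 0 y)) = 0 := by
      have h3 : G (arCoeff k a 0 y) ∈ tau0 k a := hA.isGeneralizedInverse.apply_mem _
      rw [hvy, S1_apply_of_mem_tau0 h3, inner_zero_right]
    have h3 := hpS _ h1
    rw [inner_sub_right, h2, sub_zero] at h3
    rw [← h3]
    simp [hq]
  -- Since pA₀ = 0, pA(z) starts with (1-z)pA₁. Subtracting (1-z)qA(z) gives (1-z)⟨v,·⟩ up to tails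
  -- of order (1-z)², which are divisible by A(z).
  refine ⟨_, (((isTransfer_arPoly p ρ).sub (h.isTransfer_tail p 2)).sub
    ((isTransfer_arPoly q ρ).smul.sub (h.isTransfer_tail q 1))).congr fun z => ?_, ?_, ?_⟩
  · ext y
    have t0 : arPoly k a z y = arCoeff k a 0 y + (1 - z) • arTail k a 1 z y := by
      rw [← arTail_zero, arTail_succ]; simp
    have t1 : p (arPoly k a z y) =
        (1 - z) * p (arCoeff k a 1 y) + (1 - z) ^ 2 * p (arTail k a 2 z y) := by
      simp [arPoly_eq, hp0]
    simp only [sub_apply, smul_apply, ContinuousLinearMap.comp_apply, innerSL_apply_apply, t1,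
      smul_eq_mul, hvp y]
    rw [t0, map_add, map_smul, smul_eq_mul]
    ring
  · have h1 := apply_pivot_of_mem_tau1 hpiv hv
    have h2 := hpS v (arCoeff_zero_apply_of_mem_tau1 hv)
    rw [pivot_of_mem_tau1 hv] at h1 ⊢
    simp [h1, h2]
  · intro u hu
    have h1 := apply_pivot_of_mem_tau0 hpiv hu
    rw [pivot_of_mem_tau0 hu] at h1 ⊢
    simp [h1, hp0]

/-- For `v = v₀ + v₁ ∈ τ₀ ⊕ τ₁` the functional `(1 - z) ⟨v, ·⟩` is divisible by `A(z)`. -/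
theorem exists_isTransfer_add {v₀ v₁ : H} (hv₀ : v₀ ∈ tau0 k a) (hv₁ : v₁ ∈ tau1 k a) :
    ∃ φ : ℂ → H →L[ℂ] ℂ, IsTransfer k a ρ (fun z => (1 - z) • innerSL ℂ (v₀ + v₁)) φ ∧
      φ 1 (pivot k a v₁) = inner ℂ v₁ v₁ ∧ ∀ u ∈ tau0 k a, φ 1 (pivot k a u) = 0 := by
  obtain ⟨φ, hφ, h1⟩ := h.exists_isTransfer_diff_tau0 hA hpiv hv₀
  obtain ⟨φ', hφ', h1', h2'⟩ := h.exists_isTransfer_tau1 hA hpiv hv₁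
  refine ⟨_, (hφ.add hφ').congr fun z => ?_, ?_, fun u hu => ?_⟩
  · rw [map_add, smul_add]
  · simp [h1, h1', apply_pivot_of_mem_tau1 hpiv hv₁]
  · simp [h1, h2' u hu, apply_pivot_of_mem_tau0 hpiv hu]

end IsRegularInverse

omit [CompleteSpace H] [MeasurableSpace Ω] in
theorem diffOp_iterate_characteristic (v : H) (x : ℤ → Ω → H) (m : ℕ) :
    diffOp^[m] (characteristic v x) = fun t ω => innerSL ℂ v (diffOp^[m] x t ω) := by
  funext t ω
  rw [diffOp_iterate_apply, diffOp_iterate_apply]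
  exact diffOp_iterate_map (innerSL ℂ v : H →+ ℂ) m (fun s => x s ω) t

omit [CompleteSpace H] in
theorem hasSymbol_characteristic (v : H) (x : ℤ → Ω → H) (m : ℕ) :
    HasSymbol P x (fun z => (1 - z) ^ m • innerSL ℂ v) (diffOp^[m] (characteristic v x)) := by
  rw [diffOp_iterate_characteristic]
  refine ((hasSymbol_self.diff_iterate m).clm_comp (innerSL ℂ v)).congr (r := 2) (by norm_num)
    fun z _ => ?_
  ext y
  simp

/-! ### Orders of integration of the scalar processes ⟨v, x_t⟩. -/

section Orders

variable [IsProbabilityMeasure P] (h : IsRegularInverse k a F ρ)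
  (hA : HasUnitRootOfFiniteType k a) (hpiv : F 1 * pivot k a = proj2 k a)
  (hε : IsWhiteNoise P ε) (hx : IsARSolution P k a ε x)
include h hA hpiv hε hx

theorem IsRegularInverse.isScalarIntegratedOfOrder_zero {v : H} (hv0 : v ≠ 0)
    (hv : v ∈ tau0 k a) : IsScalarIntegratedOfOrder P ε 0 (fun t ω => characteristic v x t ω +
      inner ℂ v (generalizedInverse (arCoeff k a 0) (arCoeff k a 1 (diffOp x t ω)))) := by
  obtain ⟨φ, hφ, h1⟩ := h.exists_isTransfer_tau0 hA hpiv hv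
  have s1 := (hasSymbol_characteristic (P := P) v x 0).add
    ((hasSymbol_self (P := P) (e := x)).diff.clm_comp (gainFunctional k a v))
  refine (hφ.hasSymbol h.one_lt hx (s1.congr (r := 2) (by norm_num) fun z _ => ?_)
    ).isScalarIntegratedOfOrder (d := 0) (fun h2 => ?_) hx.hasPolynomialGrowth_noise hε.mean_zero
  · ext y
    simp
  · rw [h2] at h1
    exact hv0 (inner_self_eq_zero.1 h1.symm)

theorem IsRegularInverse.isScalarIntegratedOfOrder_one {v : H} (hv0 : v ≠ 0)
    (hv : v ∈ tau1 k a) : IsScalarIntegratedOfOrder P ε 1 (characteristic v x) := by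
  obtain ⟨φ, hφ, h1, -⟩ := h.exists_isTransfer_tau1 hA hpiv hv
  have s1 := hasSymbol_characteristic (P := P) v x 1
  simp only [pow_one] at s1
  refine (hφ.hasSymbol h.one_lt hx s1).isScalarIntegratedOfOrder (fun h2 => ?_)
    hx.hasPolynomialGrowth_noise hε.mean_zero
  rw [h2] at h1
  exact hv0 (inner_self_eq_zero.1 h1.symm)

-- The leading functional is ⟨v, F(1)·⟩; evaluated at Mv, with M the pivot, it gives ‖v‖² because
-- F(1)Mv = v.
omit hA in
theorem IsRegularInverse.isScalarIntegratedOfOrder_two {v : H} (hv0 : v ≠ 0)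
    (hv : v ∈ (tau0 k a ⊔ tau1 k a)ᗮ) :
    IsScalarIntegratedOfOrder P ε 2 (characteristic v x) := by
  refine ((h.isTransfer (innerSL ℂ v)).hasSymbol h.one_lt hx
    (hasSymbol_characteristic (P := P) v x 2)).isScalarIntegratedOfOrder (fun h2 => ?_)
    hx.hasPolynomialGrowth_noise hε.mean_zero
  have h3 := congrArg (fun T : H →L[ℂ] ℂ => T (pivot k a v)) h2
  have h4 := congrArg (fun T : H →L[ℂ] H => T v) hpiv
  simp only [mul_apply_eq_comp] at h4
  simp only [ContinuousLinearMap.comp_apply, h4, proj2_of_mem hv, innerSL_apply_apply,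
    zero_apply] at h3
  exact hv0 (inner_self_eq_zero.1 h3)

/-- A nonzero τ₁ component gives order 1. For v in τ₀ the order is 1 if ⟨v, A₀⁺A₁F(1)·⟩ ≠ 0;
otherwise the gain term can be removed as well and the order is 0. -/
theorem IsRegularInverse.exists_isScalarIntegratedOfOrder {v : H} (hv0 : v ≠ 0)
    (hv : v ∈ tau0 k a ⊔ tau1 k a) :
    ∃ b < 2, IsScalarIntegratedOfOrder P ε b (characteristic v x) := by
  obtain ⟨v₀, hv₀, v₁, hv₁, rfl⟩ := Submodule.mem_sup.1 hv
  have hgr := hx.hasPolynomialGrowth_noise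
  have s1 := hasSymbol_characteristic (P := P) (v₀ + v₁) x 1
  simp only [pow_one] at s1
  by_cases h1 : v₁ = 0
  · subst h1
    simp only [add_zero] at s1 hv0 ⊢
    by_cases h2 : (gainFunctional k a v₀).comp (F 1) = 0
    · obtain ⟨φ, hφ, e1⟩ := h.exists_isTransfer_tau0 hA hpiv hv₀
      obtain ⟨g, hg⟩ : ∃ g : H, innerSL ℂ g = gainFunctional k a v₀ :=
        (InnerProductSpace.toDual ℂ H).surjective _
      -- The representative of the gain functional is orthogonal to Im F(1), hence lies in τ₀⊕τ₁, so
      -- (1-z)⟨g,·⟩ is divisible by A(z) and may be subtracted.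
      have hgm : g ∈ tau0 k a ⊔ tau1 k a := by
        rw [← hA.orthogonal_orthogonal_sup, Submodule.mem_orthogonal']
        intro y hy
        have e2 := congrArg (fun T : H →L[ℂ] H => T y) hpiv
        simp only [mul_apply_eq_comp, proj2_of_mem hy] at e2
        have e3 := congrArg (fun T : H →L[ℂ] ℂ => T (pivot k a y)) h2
        simpa [← hg, e2] using e3
      obtain ⟨g₀, hg₀, g₁, hg₁, rfl⟩ := Submodule.mem_sup.1 hgm
      obtain ⟨φ', hφ', -, e2⟩ := h.exists_isTransfer_add hA hpiv hg₀ hg₁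
      refine ⟨0, two_pos, ((hφ.sub hφ').hasSymbol h.one_lt hx
        ((hasSymbol_characteristic (P := P) v₀ x 0).congr (r := 2) (by norm_num)
          fun z _ => ?_)).isScalarIntegratedOfOrder (d := 0) (fun h3 => ?_) hgr hε.mean_zero⟩
      · rw [hg]; module
      · have h4 := congrArg (fun T : H →L[ℂ] ℂ => T (pivot k a v₀)) h3
        simp only [sub_apply, e1, e2 v₀ hv₀, sub_zero, zero_apply] at h4
        exact hv0 (inner_self_eq_zero.1 h4)
    · obtain ⟨φ, hφ, e1⟩ := h.exists_isTransfer_diff_tau0 hA hpiv hv₀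
      exact ⟨1, one_lt_two, (hφ.hasSymbol h.one_lt hx s1).isScalarIntegratedOfOrder
        (by rw [e1]; exact neg_ne_zero.2 h2) hgr hε.mean_zero⟩
  · obtain ⟨φ, hφ, e1, -⟩ := h.exists_isTransfer_add hA hpiv hv₀ hv₁
    refine ⟨1, one_lt_two, (hφ.hasSymbol h.one_lt hx s1).isScalarIntegratedOfOrder
      (fun h2 => ?_) hgr hε.mean_zero⟩
    rw [h2] at e1
    exact h1 (inner_self_eq_zero.1 e1.symm)

-- Differencing an I(b) representation 2 - b ≥ 1 more times gives a symbol that vanishes at 1, and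
-- by uniqueness it coincides with ⟨v, F(z)·⟩.
omit hA hpiv in
theorem IsRegularInverse.inner_eq_zero_of_isScalarIntegratedOfOrder (hn : IsNondegenerate P ε)
    {v : H} {b : ℕ} (hb : b < 2) (hv : IsScalarIntegratedOfOrder P ε b (characteristic v x))
    (y : H) : inner ℂ v (F 1 y) = 0 := by
  obtain ⟨f, hf, -⟩ := hv
  obtain ⟨m, hm⟩ : ∃ m, m + b = 2 := ⟨2 - b, by omega⟩
  have hm0 : m ≠ 0 := by omega
  set w := characteristic v x with hw
  set μ : ℤ → ℂ := fun t => ∫ ω', diffOp^[b] w t ω' ∂P with hμ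
  have s1 : HasSymbol P ε (fun z => ∑' n, z ^ n • f n) (fun t ω => diffOp^[b] w t ω - μ t) :=
    ⟨f, hf.absConv.isDiscSeries, hf.hasSum⟩
  have s2 := (h.isTransfer (innerSL ℂ v)).hasSymbol h.one_lt hx
    (hasSymbol_characteristic (P := P) v x 2)
  obtain ⟨r, hr, hr0⟩ := hn.symbol_eq_zero hε hx.hasPolynomialGrowth_noise
    ((s1.diff_iterate m).sub s2) (t := 0) (c := -diffOp^[m] μ 0)
    (Filter.Eventually.of_forall fun ω => by
      rw [diffOp_iterate_apply, diffOp_iterate_sub, ← hw, ← hm, Function.iterate_add_apply,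
        diffOp_iterate_apply m]
      ring)
  have h1 := congrArg (fun T : H →L[ℂ] ℂ => T y) (hr0 1 (by simpa using hr))
  simpa [hm0] using h1

end Orders

end Cointegration

/-! ## Characterization of `I(2)` autoregressive processes -/

theorem mainTheorem7 {H : Type*} [NormedAddCommGroup H] [InnerProductSpace ℂ H] [CompleteSpace H]
    [TopologicalSpace.SeparableSpace H]
    {Ω : Type*} [MeasurableSpace Ω] (P : Measure Ω) [IsProbabilityMeasure P]
    (k : ℕ) (a : ℕ → H →L[ℂ] H) (hA : HasUnitRootOfFiniteType k a)
    (ε x : ℤ → Ω → H) (hε : IsWhiteNoise P ε) (hx : IsARSolution P k a ε x) :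
    (IsNondegenerate P ε → (IsIntegratedOfOrder P ε 2 x ↔ PoleTwoCondition k a)) ∧
    (PoleTwoCondition k a →
      IsIntegratedOfOrder P ε 2 x ∧
      (∃ (C Cstar : ℕ → H →L[ℂ] H) (y : ℤ → Ω → H) (v₀ v₁ : Ω → H),
        IsLaurentExpansionOfInverse k a 2 C ∧
        IsCommonTrendsRepresentationTwo P k a ε x C Cstar y v₀ v₁ ∧
        (C 0).range = tau2 k a ∧
        (IsNondegenerate P ε → attractorSpace P ε 2 x = (C 0).range)) ∧
      FiniteDimensional ℂ (tau2 k a) ∧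
      (IsNondegenerate P ε →
        cointegratingSpace P ε 2 x = ((tau0 k a ⊔ tau1 k a : Submodule ℂ H) : Set H)) ∧
      (¬ FiniteDimensional ℂ H →
        ¬ FiniteDimensional ℂ (tau0 k a ⊔ tau1 k a : Submodule ℂ H)) ∧
      (∀ v : H, v ≠ 0 →
        (v ∈ tau0 k a → IsScalarIntegratedOfOrder P ε 0
          (fun t ω => characteristic v x t ω +
            inner ℂ v (generalizedInverse (arCoeff k a 0)
              (arCoeff k a 1 (diffOp x t ω))))) ∧
        (v ∈ tau1 k a → IsScalarIntegratedOfOrder P ε 1 (characteristic v x)) ∧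
        (v ∈ tau2 k a → IsScalarIntegratedOfOrder P ε 2 (characteristic v x))) ∧
      tau1 k a < (tau0 k a)ᗮ ∧
      tau2 k a = (tau0 k a ⊔ tau1 k a)ᗮ ∧
      tau2 k a ≠ ⊥) := by
  have main : PoleTwoCondition k a → ∃ (F : ℂ → H →L[ℂ] H) (ρ : ℝ), IsRegularInverse k a F ρ ∧
      F 1 * pivot k a = proj2 k a ∧ (F 1).range = (tau0 k a ⊔ tau1 k a)ᗮ ∧ F 1 ≠ 0 := by
    intro hp
    obtain ⟨hS, hne⟩ := hA.poleTwoCondition_iff.1 hp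
    obtain ⟨F, ρ, hρ, hd, hu, hF, hpiv⟩ := hA.exists_regular_inverse hS
    have h : IsRegularInverse k a F ρ := ⟨hρ, hd, hu, fun z _ hz1 => hF z hz1⟩
    -- The coefficient identities give one inclusion; F(1)Mv = v, with M the pivot, gives the other.
    have hr : (F 1).range = (tau0 k a ⊔ tau1 k a)ᗮ := by
      obtain ⟨_, _, -, -, -, hcoef⟩ := h.exists_expansion
      refine le_antisymm ?_ fun v hv => ⟨pivot k a v, ?_⟩
      · rintro _ ⟨v, rfl⟩
        exact hcoef.apply_mem v
      · have h1 := congrArg (fun T : H →L[ℂ] H => T v) hpiv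
        simpa only [mul_apply_eq_comp, proj2_of_mem hv] using! h1
    refine ⟨F, ρ, h, hpiv, hr, fun h0 => hne ?_⟩
    rw [← hr, h0]
    exact LinearMap.range_zero
  refine ⟨fun hn => ⟨fun hI => ?_, fun hp => ?_⟩, fun hp => ?_⟩
  · obtain ⟨F, ρ, h, h1⟩ := hI.exists_isRegularInverse hA hn hε hx
    obtain ⟨_, _, -, -, -, hcoef⟩ := h.exists_expansion
    exact hcoef.poleTwoCondition hA h1
  · obtain ⟨F, ρ, h, -, -, h1⟩ := main hp
    exact h.isIntegratedOfOrder_two h1 hε hx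
  obtain ⟨F, ρ, h, hpiv, hr, h1⟩ := main hp
  obtain ⟨hS, hne⟩ := hA.poleTwoCondition_iff.1 hp
  have ht2 := hA.tau2_eq_iff.2 hS
  have hoo := hA.orthogonal_orthogonal_sup
  have hfin : FiniteDimensional ℂ (tau2 k a) := by
    have := hA.finiteDimensional_orthogonal_tau0
    rw [ht2]
    exact Submodule.finiteDimensional_of_le (Submodule.orthogonal_le le_sup_left)
  have hcoint : IsNondegenerate P ε →
      cointegratingSpace P ε 2 x = ((tau0 k a ⊔ tau1 k a : Submodule ℂ H) : Set H) := by
    intro hn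
    ext v
    constructor
    · rintro (⟨b, hb, hv⟩ | hv)
      -- As τ₀⊕τ₁ is closed, membership is orthogonality to its complement Im F(1).
      · rw [SetLike.mem_coe, ← hoo, ← hr, Submodule.mem_orthogonal']
        rintro _ ⟨y, rfl⟩
        exact h.inner_eq_zero_of_isScalarIntegratedOfOrder hε hx hn hb hv y
      · rw [Set.mem_singleton_iff.1 hv]
        exact Submodule.zero_mem _
    · intro hv
      by_cases hv0 : v = 0
      · exact Or.inr hv0
      · exact Or.inl (h.exists_isScalarIntegratedOfOrder hA hpiv hε hx hv0 hv)
  refine ⟨h.isIntegratedOfOrder_two h1 hε hx, ?_, hfin, hcoint, fun hinf hfd => hinf ?_,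
    fun v hv0 => ⟨h.isScalarIntegratedOfOrder_zero hA hpiv hε hx hv0,
      h.isScalarIntegratedOfOrder_one hA hpiv hε hx hv0, fun hv =>
      h.isScalarIntegratedOfOrder_two hpiv hε hx hv0 (ht2 ▸ hv)⟩, ?_, ht2, hp.ne_bot⟩
  · obtain ⟨C, hC, hC0, hC1⟩ := h.exists_laurent
    obtain ⟨Cstar, y, v₀, v₁, hrep⟩ := h.exists_commonTrends hA hε hx hC0 hC1
    refine ⟨C, Cstar, y, v₀, v₁, hC, hrep, by rw [hC0, hr, ht2], fun hn => ?_⟩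
    rw [attractorSpace, hcoint hn, Submodule.span_eq, hC0, hr]
  · have h2 : tau0 k a ⊔ tau1 k a ⊔ tau2 k a = ⊤ := hp.sup_eq_top
    have h3 := Submodule.finiteDimensional_sup (tau0 k a ⊔ tau1 k a) (tau2 k a)
    rw [h2] at h3
    exact Module.Finite.equiv (Submodule.topEquiv (R := ℂ) (M := H))
  -- Equality would make τ₀⊕τ₁ the whole space and its complement trivial.
  · refine lt_of_le_of_ne tau1_le fun heq => hne ?_
    rw [heq, Submodule.sup_orthogonal_of_hasOrthogonalProjection, Submodule.top_orthogonal_eq_bot]
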